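/- Let $n\ge 1$ and let $\mathrm{Sp}(n)=\{S\in \mathrm U(2n) : S^{T}JS=J\}$ with $J=\begin{pmatrix}0&I_n\\-I_n&0\end{pmatrix}$, acting on complex $2n\times 2n$ matrices by $S\cdot\rho=S\rho S^{\dagger}$. Say that the orbit $\mathrm{Sp}(n)\cdot\rho$ is a homogeneous manifold of real dimension $d$ if $\mathrm{Sp}(n)$ is a smooth Lie group and $\mathrm{Sp}(n)\cdot\rho$ a smooth manifold of dimension $d$, both smoothly embedded in the real vector space of complex $2n\times 2n$ matrices, the action of $\mathrm{Sp}(n)$ on $\mathrm{Sp}(n)\cdot\rho$ is smooth, and the natural map $\mathrm{Sp}(n)/\mathrm{Sp}(n)_\rho\to \mathrm{Sp}(n)\cdot\rho$ is a homeomorphism, where $\mathrm{Sp}(n)_\rho=\{S\in \mathrm{Sp}(n): S\rho S^\dagger=\rho\}$. (1) If $\rho=\mathrm{diag}(\sigma,\sigma)$, where $\sigma$ is a diagonal positive semidefinite $n\times n$ matrix (of any trace) that is not a multiple of $I_n$, then the orbit of $\rho$ under $\mathrm{Sp}(n)$ is a homogeneous manifold of some real dimension $d\le 2n^2-1$. (2)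 If $\rho=\mathrm{diag}(aI_n,bI_n)$ with real numbers $0\le a,b\le 1$ and $a\neq b$, then the stabilizer of $\rho$ in $\mathrm{Sp}(n)$ is $\{\mathrm{diag}(A,A^{*}) : A\in \mathrm U(n)\}$, where $A^{*}$ is the entrywise complex conjugate of $A$, and the orbit of $\rho$ under $\mathrm{Sp}(n)$ is a homogeneous manifold of real dimension $n^2+n$. -/

import Mathlib

open scoped Manifold ContDiff ComplexOrder

noncomputable section

/-- Complex `2n × 2n` matrices, written in `n × n` blocks. -/
abbrev BlockMat (n : ℕ) : Type := Matrix (Fin n ⊕ Fin n) (Fin n ⊕ Fin n) ℂ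

/-- The arrays of entries of `2n × 2n` complex matrices, as a finite dimensional real normed space.
This is the space `BlockMat n` again, with the same topology; it is used as the ambient real vector
space since `Matrix` carries no global norm. -/
abbrev EntrySpace (n : ℕ) : Type := (Fin n ⊕ Fin n) → (Fin n ⊕ Fin n) → ℂ

/-- The matrix `J = [[0, I], [-I, 0]]`. -/
def sympJ (n : ℕ) : BlockMat n := Matrix.fromBlocks 0 1 (-1) 0

/-- The compact symplectic group `Sp(n)`: the subgroup of all `A ∈ U(2n)` with `Aᵀ J A = J`.
It carries the subspace topology of the matrices. -/
def Sp (n : ℕ) : Subgroup (Matrix.unitaryGroup (Fin n ⊕ Fin n) ℂ) where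
  carrier := {A | (A : BlockMat n).transpose * sympJ n * (A : BlockMat n) = sympJ n}
  one_mem' := by simp
  mul_mem' := by
    intro A B hA hB
    simp only [Set.mem_ofPred_eq] at hA hB ⊢
    calc ((A * B : Matrix.unitaryGroup (Fin n ⊕ Fin n) ℂ) : BlockMat n).transpose * sympJ n
          * ((A * B : Matrix.unitaryGroup (Fin n ⊕ Fin n) ℂ) : BlockMat n)
        = (B : BlockMat n).transpose
          * ((A : BlockMat n).transpose * sympJ n * (A : BlockMat n)) * (B : BlockMat n) := by
          simp [Matrix.transpose_mul, Matrix.mul_assoc]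
      _ = sympJ n := by rw [hA, hB]
  inv_mem' := by
    intro A hA
    simp only [Set.mem_ofPred_eq] at hA ⊢
    have h : (A : BlockMat n) * ((A⁻¹ : Matrix.unitaryGroup (Fin n ⊕ Fin n) ℂ) : BlockMat n) = 1 := by
      simp
    have h' : ((A⁻¹ : Matrix.unitaryGroup (Fin n ⊕ Fin n) ℂ) : BlockMat n).transpose
        * (A : BlockMat n).transpose = 1 := by
      rw [← Matrix.transpose_mul, h, Matrix.transpose_one]
    generalize ((A⁻¹ : Matrix.unitaryGroup (Fin n ⊕ Fin n) ℂ) : BlockMat n) = B at h h' ⊢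
    calc B.transpose * sympJ n * B
        = B.transpose * ((A : BlockMat n).transpose * sympJ n * (A : BlockMat n)) * B := by rw [hA]
      _ = (B.transpose * (A : BlockMat n).transpose) * sympJ n * ((A : BlockMat n) * B) := by
          simp only [Matrix.mul_assoc]
      _ = sympJ n := by rw [h, h', Matrix.one_mul, Matrix.mul_one]

/-- The `2n × 2n` complex matrix underlying an element of `Sp(n)`. -/
def spMat {n : ℕ} (S : Sp n) : BlockMat n := ((S : Matrix.unitaryGroup (Fin n ⊕ Fin n) ℂ) : BlockMat n)

/-- The action of `Sp(n)` on matrices: `S · ρ = S ρ S†`, which is `S ρ S⁻¹` as `S` is unitary. -/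
def spConj {n : ℕ} (S : Sp n) (ρ : BlockMat n) : BlockMat n :=
  spMat S * ρ * (spMat S).conjTranspose

theorem spConj_one {n : ℕ} (ρ : BlockMat n) : spConj (1 : Sp n) ρ = ρ := by
  simp [spConj, spMat]

theorem spConj_mul {n : ℕ} (S T : Sp n) (ρ : BlockMat n) :
    spConj (S * T) ρ = spConj S (spConj T ρ) := by
  simp [spConj, spMat, Matrix.conjTranspose_mul, Matrix.mul_assoc]

/-- The symplectic orbit `Sp(n) · ρ`, with the subspace topology of the matrices. -/
def spOrbit {n : ℕ} (ρ : BlockMat n) : Set (BlockMat n) := Set.range fun S : Sp n => spConj S ρ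

/-- The isotropy subgroup (stabilizer) of `ρ` in `Sp(n)`. -/
def spStabilizer {n : ℕ} (ρ : BlockMat n) : Subgroup (Sp n) where
  carrier := {S | spConj S ρ = ρ}
  one_mem' := spConj_one ρ
  mul_mem' := by
    intro S T hS hT
    simp only [Set.mem_ofPred_eq] at hS hT ⊢
    rw [spConj_mul, hT, hS]
  inv_mem' := by
    intro S hS
    simp only [Set.mem_ofPred_eq] at hS ⊢
    calc spConj S⁻¹ ρ = spConj S⁻¹ (spConj S ρ) := by rw [hS]
      _ = ρ := by rw [← spConj_mul, inv_mul_cancel, spConj_one]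

/-- The action of `Sp(n)` on the orbit of `ρ`. -/
def spOrbitAct {n : ℕ} (ρ : BlockMat n) (S : Sp n) (x : spOrbit ρ) : spOrbit ρ :=
  ⟨spConj S x, by
    obtain ⟨T, hT⟩ := x.2
    exact ⟨S * T, by simp only [spConj_mul]; rw [← hT]⟩⟩

/-- The natural map `Sp(n) / Sp(n)_ρ → Sp(n) · ρ`, `S Sp(n)_ρ ↦ S ρ S†`. -/
def spQuotientMap {n : ℕ} (ρ : BlockMat n) : (Sp n ⧸ spStabilizer ρ) → spOrbit ρ :=
  Quotient.lift (s := QuotientGroup.leftRel (spStabilizer ρ)) (fun S : Sp n => (⟨spConj S ρ, S, rfl⟩ : spOrbit ρ)) (by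
    intro S T hST
    have h : spConj (S⁻¹ * T) ρ = ρ := QuotientGroup.leftRel_apply.mp hST
    refine Subtype.ext ?_
    change spConj S ρ = spConj T ρ
    calc spConj S ρ = spConj S (spConj (S⁻¹ * T) ρ) := by rw [h]
      _ = spConj T ρ := by rw [← spConj_mul, mul_inv_cancel_left])

/-- The symplectic orbit of `ρ` is a homogeneous manifold of real dimension `d`.

There are manifold structures, modelled on `ℝᵐ` and on `ℝᵈ` respectively, on the topological spaces
`Sp(n)` and `Sp(n) · ρ`, such that
* `Sp(n)` is a smooth Lie group, smoothly embedded in the real vector space of complex matrices;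
* `Sp(n) · ρ` is a smooth manifold, smoothly embedded in that vector space (these two embeddings
  make both smooth structures unique);
* the action of `Sp(n)` on `Sp(n) · ρ` by conjugation is smooth;
* `Sp(n) / Sp(n)_ρ → Sp(n) · ρ` is a homeomorphism (so in particular the action is transitive). -/
def IsHomogeneousManifoldOfDim {n : ℕ} (ρ : BlockMat n) (d : ℕ) : Prop :=
  ∃ (m : ℕ) (_ : ChartedSpace (EuclideanSpace ℝ (Fin m)) (Sp n))
    (_ : ChartedSpace (EuclideanSpace ℝ (Fin d)) (spOrbit ρ)),
    LieGroup (𝓡 m) ∞ (Sp n) ∧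
    Manifold.IsSmoothEmbedding (𝓡 m) 𝓘(ℝ, EntrySpace n) ∞
      (fun (S : Sp n) (i j : Fin n ⊕ Fin n) => spMat S i j) ∧
    IsManifold (𝓡 d) ∞ (spOrbit ρ) ∧
    Manifold.IsSmoothEmbedding (𝓡 d) 𝓘(ℝ, EntrySpace n) ∞
      (fun (x : spOrbit ρ) (i j : Fin n ⊕ Fin n) => (x : BlockMat n) i j) ∧
    ContMDiff ((𝓡 m).prod (𝓡 d)) (𝓡 d) ∞
      (fun p : Sp n × spOrbit ρ => spOrbitAct ρ p.1 p.2) ∧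
    IsHomeomorph (spQuotientMap ρ)

end

/-! Every orbit of a compact group acting linearly is an embedded submanifold, and its dimension is
the rank of the infinitesimal action at the base point. Here that action is `X ↦ X ρ - ρ X` on the
Lie algebra `sp(n)`, so `isHomogeneousManifoldOfDim_finrank` holds for every `ρ` and both claims
about orbits reduce to linear algebra.

The geometric core is `IsLocalGroupParam.exists_isSliceChart_orbit`: the inverse function theorem
flattens the orbit near one point, compactness excludes other sheets of the orbit there, and the
group carries the chart to all other points. The Cayley transform serves as the smooth
parametrization of `Sp(n)` near `1`. Applied to left multiplication on the identity matrix, the same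
theorem makes `Sp(n)` itself a manifold; applied to conjugation, it treats the orbit. Group law,
inversion and action are restrictions of polynomial maps of the ambient matrices (over the reals),
hence smooth.

An element of `sp(n)` has blocks `A, B, -B†, -Aᵀ` with `A` skew-Hermitian and `B` symmetric. For `ρ
= diag(σ, σ)` the bracket scales `A i j` and `B i j` by differences of eigenvalues, which vanish for
`i = j`, leaving at most `2n² - 2n` real dimensions. For `ρ = diag(aI, bI)` only `(b - a) B`
survives, and complex symmetric matrices have real dimension `n² + n`. -/

open Topology Set Filter

/-! ### Manifold structure from slice charts. -/

section SliceCharts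

variable {E V W : Type*} [NormedAddCommGroup E] [NormedSpace ℝ E]
  [NormedAddCommGroup V] [NormedSpace ℝ V] [NormedAddCommGroup W] [NormedSpace ℝ W]

/-- A smooth chart of `E` with values in `V × W` in which the set `R` is the slice `V × {0}`. -/
structure IsSliceChart (R : Set E) (Φ : OpenPartialHomeomorph E (V × W)) : Prop where
  contDiffOn : ContDiffOn ℝ ∞ Φ Φ.source
  contDiffOn_symm : ContDiffOn ℝ ∞ Φ.symm Φ.target
  mem_iff : ∀ y ∈ Φ.source, (y ∈ R ↔ (Φ y).2 = 0)

theorem IsSliceChart.exists_preimage {X : Type*} {ι : X → E} {Φ : OpenPartialHomeomorph E (V × W)}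
    (hΦ : IsSliceChart (range ι) Φ) {v : V} (hv : (v, (0 : W)) ∈ Φ.target) :
    ∃ x, ι x = Φ.symm (v, 0) :=
  (hΦ.mem_iff _ (Φ.map_target hv)).2 (by rw [Φ.right_inv hv])

variable {X : Type*} [TopologicalSpace X] {ι : X → E}

open Classical in
/-- The chart of `X` obtained from a slice chart of an embedding `ι : X → E`. -/
noncomputable def IsSliceChart.chart {Φ : OpenPartialHomeomorph E (V × W)}
    (hΦ : IsSliceChart (range ι) Φ) (hι : IsEmbedding ι) (x₀ : X) :
    OpenPartialHomeomorph X V where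
  toFun x := (Φ (ι x)).1
  -- Injectivity of `ι` makes the chosen preimage unique; `x₀` is only a default value off the
  -- target.
  invFun v := if h : (v, (0 : W)) ∈ Φ.target then (hΦ.exists_preimage h).choose else x₀
  source := ι ⁻¹' Φ.source
  target := {v | (v, (0 : W)) ∈ Φ.target}
  map_source' x hx := by
    have h0 : (Φ (ι x)).2 = 0 := (hΦ.mem_iff _ hx).1 ⟨x, rfl⟩
    have : ((Φ (ι x)).1, (0 : W)) = Φ (ι x) := Prod.ext rfl h0.symm
    rw [mem_ofPred_eq, this]
    exact Φ.map_source hx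
  map_target' v hv := by
    have hv' : (v, (0 : W)) ∈ Φ.target := hv
    rw [mem_preimage, dif_pos hv', (hΦ.exists_preimage hv').choose_spec]
    exact Φ.map_target hv'
  left_inv' x hx := by
    have h0 : (Φ (ι x)).2 = 0 := (hΦ.mem_iff _ hx).1 ⟨x, rfl⟩
    have h1 : ((Φ (ι x)).1, (0 : W)) = Φ (ι x) := Prod.ext rfl h0.symm
    have h2 : ((Φ (ι x)).1, (0 : W)) ∈ Φ.target := h1 ▸ Φ.map_source hx
    rw [dif_pos h2]
    apply hι.injective
    rw [(hΦ.exists_preimage h2).choose_spec, h1, Φ.left_inv hx]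
  right_inv' v hv := by
    have hv' : (v, (0 : W)) ∈ Φ.target := hv
    rw [dif_pos hv', (hΦ.exists_preimage hv').choose_spec, Φ.right_inv hv']
  open_source := Φ.open_source.preimage hι.continuous
  open_target := Φ.open_target.preimage (Continuous.prodMk_left 0)
  continuousOn_toFun :=
    continuous_fst.comp_continuousOn
      (Φ.continuousOn.comp hι.continuous.continuousOn fun _ hx => hx)
  continuousOn_invFun := by
    rw [hι.isInducing.continuousOn_iff]
    have h : ContinuousOn (fun v : V => Φ.symm (v, (0 : W))) {v | (v, (0 : W)) ∈ Φ.target} :=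
      Φ.continuousOn_symm.comp (Continuous.prodMk_left 0).continuousOn fun _ hv => hv
    refine h.congr fun v hv => ?_
    have hv' : (v, (0 : W)) ∈ Φ.target := hv
    rw [Function.comp_apply, dif_pos hv', (hΦ.exists_preimage hv').choose_spec]

theorem IsSliceChart.chart_source {Φ : OpenPartialHomeomorph E (V × W)}
    (hΦ : IsSliceChart (range ι) Φ) (hι : IsEmbedding ι) (x₀ : X) :
    (hΦ.chart hι x₀).source = ι ⁻¹' Φ.source := rfl

theorem IsSliceChart.chart_target {Φ : OpenPartialHomeomorph E (V × W)}
    (hΦ : IsSliceChart (range ι) Φ) (hι : IsEmbedding ι) (x₀ : X) :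
    (hΦ.chart hι x₀).target = {v | (v, (0 : W)) ∈ Φ.target} := rfl

theorem IsSliceChart.map_chart_symm {Φ : OpenPartialHomeomorph E (V × W)}
    (hΦ : IsSliceChart (range ι) Φ) (hι : IsEmbedding ι) (x₀ : X) {v : V}
    (hv : (v, (0 : W)) ∈ Φ.target) : ι ((hΦ.chart hι x₀).symm v) = Φ.symm (v, 0) := by
  classical
  change ι (if h : (v, (0 : W)) ∈ Φ.target then (hΦ.exists_preimage h).choose else x₀) = _
  rw [dif_pos hv, (hΦ.exists_preimage hv).choose_spec]

/-- A topological embedding whose range has slice charts at all points is a smooth embedding, for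
a suitable smooth structure on the source. -/
theorem exists_isSmoothEmbedding_of_isSliceChart (hι : IsEmbedding ι) (L : (V × W) ≃L[ℝ] E)
    (h : ∀ x, ∃ Φ : OpenPartialHomeomorph E (V × W),
      ι x ∈ Φ.source ∧ IsSliceChart (range ι) Φ) :
    ∃ _ : ChartedSpace V X, IsManifold 𝓘(ℝ, V) ∞ X ∧
      Manifold.IsSmoothEmbedding 𝓘(ℝ, V) 𝓘(ℝ, E) ∞ ι := by
  choose Φ hmem hΦ using h
  let cs : ChartedSpace V X :=
    { atlas := range fun x => (hΦ x).chart hι x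
      chartAt := fun x => (hΦ x).chart hι x
      mem_chart_source := fun x => hmem x
      chart_mem_atlas := fun x => ⟨x, rfl⟩ }
  have hman : IsManifold 𝓘(ℝ, V) ∞ X := by
    apply isManifold_of_contDiffOn
    rintro _ _ ⟨x, rfl⟩ ⟨y, rfl⟩
    simp only [modelWithCornersSelf_coe, modelWithCornersSelf_coe_symm, Function.id_comp,
      Function.comp_id, preimage_id, range_id, inter_univ]
    have hsub : ∀ v ∈ ((hΦ x).chart hι x).symm.trans ((hΦ y).chart hι y) |>.source,
        (v, (0 : W)) ∈ (Φ x).target ∧ (Φ x).symm (v, 0) ∈ (Φ y).source := by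
      intro v hv
      rw [OpenPartialHomeomorph.trans_source] at hv
      have h1 : (v, (0 : W)) ∈ (Φ x).target := hv.1
      refine ⟨h1, ?_⟩
      have h2 := hv.2
      rwa [mem_preimage, (hΦ y).chart_source, mem_preimage, (hΦ x).map_chart_symm hι x h1] at h2
    -- A change of charts is the ambient map `Φ y ∘ (Φ x).symm` restricted to the slice `W = 0` and
    -- projected to `V`.
    have hs : ContDiffOn ℝ ∞ (fun v : V => (Φ y ((Φ x).symm (v, (0 : W)))).1)
        (((hΦ x).chart hι x).symm.trans ((hΦ y).chart hι y)).source := by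
      refine contDiff_fst.comp_contDiffOn ((hΦ y).contDiffOn.comp ?_ fun v hv => (hsub v hv).2)
      exact (hΦ x).contDiffOn_symm.comp (by fun_prop) fun v hv => (hsub v hv).1
    refine hs.congr fun v hv => ?_
    change (Φ y (ι (((hΦ x).chart hι x).symm v))).1 = _
    rw [(hΦ x).map_chart_symm hι x (hsub v hv).1]
  refine ⟨cs, hman, ⟨?_, hι⟩⟩
  apply Manifold.IsImmersionOfComplement.isImmersion (F := W)
  intro x
  -- In these charts `ι` reads `v ↦ (v, 0)`, the normal form of an immersion; `L` turns the slice
  -- chart into an `E`-valued chart of `E`.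
  refine Manifold.IsImmersionAtOfComplement.mk_of_charts L ((hΦ x).chart hι x)
    ((Φ x).trans L.toHomeomorph.toOpenPartialHomeomorph) (hmem x) (by simpa using hmem x)
    (IsManifold.subset_maximalAtlas ⟨x, rfl⟩) ?_ ?_ ?_
  · refine StructureGroupoid.mem_maximalAtlas_of_mem_groupoid _ ?_
    rw [contDiffGroupoid, mem_groupoid_of_pregroupoid]
    simp only [contDiffPregroupoid, modelWithCornersSelf_coe, modelWithCornersSelf_coe_symm,
      Function.id_comp, Function.comp_id, preimage_id, range_id, inter_univ]
    constructor
    · exact L.contDiff.comp_contDiffOn ((hΦ x).contDiffOn.mono (by simp))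
    · refine (hΦ x).contDiffOn_symm.comp L.symm.contDiff.contDiffOn fun y hy => ?_
      simpa using hy
  · intro y hy
    simpa using (show ι y ∈ (Φ x).source from hy)
  · intro v hv
    have hv' : (v, (0 : W)) ∈ (Φ x).target := by
      simpa [(hΦ x).chart_target] using hv
    simp [(hΦ x).map_chart_symm hι x hv', (Φ x).right_inv hv']

end SliceCharts

/-! ### Smooth inverse function theorem. -/

section InverseFunction

variable {E F : Type*} [NormedAddCommGroup E] [NormedSpace ℝ E] [CompleteSpace E]
  [NormedAddCommGroup F] [NormedSpace ℝ F]

/-- The inverse function theorem for smooth maps, with smoothness on the whole domain. -/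
theorem ContDiff.exists_openPartialHomeomorph {f : E → F} (hf : ContDiff ℝ ∞ f) {a : E}
    {f' : E ≃L[ℝ] F} (hf' : HasFDerivAt f (f' : E →L[ℝ] F) a) :
    ∃ Ψ : OpenPartialHomeomorph E F, a ∈ Ψ.source ∧ (Ψ : E → F) = f ∧
      ContDiffOn ℝ ∞ Ψ.symm Ψ.target := by
  -- Invertibility of the derivative is an open condition. Restricting to it makes the local inverse
  -- smooth on its whole target, not just at `f a`.
  have hopen : IsOpen {x | fderiv ℝ f x ∈ range ((↑) : (E ≃L[ℝ] F) → E →L[ℝ] F)} :=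
    ContinuousLinearEquiv.isOpen.preimage (hf.continuous_fderiv (by simp))
  have ha : a ∈ {x | fderiv ℝ f x ∈ range ((↑) : (E ≃L[ℝ] F) → E →L[ℝ] F)} :=
    ⟨f', hf'.fderiv.symm⟩
  set Ψ₀ := hf.contDiffAt.toOpenPartialHomeomorph f hf' (by simp) with hΨ₀
  have hΨ₀f : (Ψ₀ : E → F) = f := rfl
  refine ⟨Ψ₀.restrOpen _ hopen, ⟨?_, ha⟩, hΨ₀f, fun y hy => ?_⟩
  · exact hf.contDiffAt.mem_toOpenPartialHomeomorph_source hf' (by simp)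
  · have hy' := (Ψ₀.restrOpen _ hopen).map_target hy
    obtain ⟨e, he⟩ := hy'.2
    refine ContDiffAt.contDiffWithinAt ?_
    refine (Ψ₀.restrOpen _ hopen).contDiffAt_symm hy (f₀' := e) ?_ hf.contDiffAt
    rw [he]
    exact (hf.differentiable (by simp)).differentiableAt.hasFDerivAt

end InverseFunction

/-! ### Orbits of linear actions of compact groups. -/

section Orbits

variable {G : Type*} [Group G] {E : Type*} [NormedAddCommGroup E] [NormedSpace ℝ E]

/-- For a compact group, points of an orbit near `x` come from group elements near `1`. -/
theorem eventually_orbit_of_eventually_nhds_one [TopologicalSpace G] [ContinuousMul G]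
    [CompactSpace G] (π : G →* (E →ₗ[ℝ] E)) {x : E}
    (hπ : Continuous fun g => π g x) {P : E → Prop} (hP : ∀ᶠ g in 𝓝 (1 : G), P (π g x)) :
    ∀ᶠ y in 𝓝 x, y ∈ range (fun g => π g x) → P y := by
  obtain ⟨N, hNP, hN, h1⟩ := mem_nhds_iff.1 hP
  -- `K` is the complement of `N · Stab(x)`. Its image is compact and misses `x`, so an orbit point
  -- near `x` is `g x` with `g h ∈ N` for some `h` fixing `x`, and then `g x = (g h) x`.
  let K : Set G := (⋃ h ∈ {h : G | π h x = x}, (fun g => g * h) ⁻¹' N)ᶜ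
  have hK : IsClosed K := by
    rw [isClosed_compl_iff]
    exact isOpen_biUnion fun h _ => hN.preimage (continuous_mul_const h)
  have hcl : IsClosed ((fun g => π g x) '' K) := (hK.isCompact.image hπ).isClosed
  have hx : x ∉ (fun g => π g x) '' K := by
    rintro ⟨g, hg, hgx⟩
    apply hg
    simp only [mem_iUnion]
    refine ⟨g⁻¹, ?_, by simpa using h1⟩
    have hgx' : π g x = x := hgx
    change π g⁻¹ x = x
    calc π g⁻¹ x = π g⁻¹ (π g x) := by rw [hgx']
      _ = x := by rw [← Module.End.mul_apply, ← map_mul, inv_mul_cancel, map_one]; rfl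
  filter_upwards [hcl.isOpen_compl.mem_nhds hx] with y hy
  rintro ⟨g, rfl⟩
  have hgK : g ∉ K := fun hg => hy ⟨g, hg, rfl⟩
  simp only [K, mem_compl_iff, not_not, mem_iUnion] at hgK
  obtain ⟨h, hh, hgh⟩ := hgK
  have hh' : π h x = x := hh
  have := hNP hgh
  rw [mem_ofPred_eq, map_mul, Module.End.mul_apply, hh'] at this
  exact this

/-- Translating a slice chart of an orbit by a group element. -/
theorem IsSliceChart.exists_translate [FiniteDimensional ℝ E] {V W : Type*} [NormedAddCommGroup V] [NormedSpace ℝ V]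
    [NormedAddCommGroup W] [NormedSpace ℝ W] (π : G →* (E →ₗ[ℝ] E)) {x : E}
    {Φ : OpenPartialHomeomorph E (V × W)} (hΦ : IsSliceChart (range fun g => π g x) Φ)
    (hx : x ∈ Φ.source) (g : G) :
    ∃ Φ' : OpenPartialHomeomorph E (V × W), π g x ∈ Φ'.source ∧
      IsSliceChart (range fun g => π g x) Φ' := by
  have hinv : ∀ (g : G) (y : E), π g⁻¹ (π g y) = y := fun g y => by
    rw [← Module.End.mul_apply, ← map_mul, inv_mul_cancel, map_one]; rfl
  have hinv' : ∀ (g : G) (y : E), π g (π g⁻¹ y) = y := fun g y => by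
    rw [← Module.End.mul_apply, ← map_mul, mul_inv_cancel, map_one]; rfl
  let e : E ≃L[ℝ] E := (LinearEquiv.ofLinearMap (π g⁻¹) (π g) (LinearMap.ext (hinv g))
    (LinearMap.ext (hinv' g))).toContinuousLinearEquiv
  have he : ∀ y, e y = π g⁻¹ y := fun _ => rfl
  have hes : ∀ y, e.symm y = π g y := fun _ => rfl
  refine ⟨e.toHomeomorph.toOpenPartialHomeomorph.trans Φ, ?_, ?_, ?_, ?_⟩
  · simpa [he, hinv] using hx
  · refine hΦ.contDiffOn.comp e.contDiff.contDiffOn fun y hy => ?_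
    simpa using hy
  · exact e.symm.contDiff.comp_contDiffOn (hΦ.contDiffOn_symm.mono (by simp))
  · intro y hy
    have hy' : e y ∈ Φ.source := by simpa using hy
    change _ ↔ (Φ (e y)).2 = 0
    rw [← hΦ.mem_iff _ hy', he]
    constructor
    · rintro ⟨k, rfl⟩
      exact ⟨g⁻¹ * k, by simp⟩
    · rintro ⟨k, hk⟩
      refine ⟨g * k, ?_⟩
      change π k x = _ at hk
      change π (g * k) x = y
      rw [map_mul, Module.End.mul_apply, hk, hinv']

end Orbits

/-! ### Slice charts of orbits from a local parametrization of the group. -/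

section OrbitSlices

variable {G : Type*} [Group G] [TopologicalSpace G]
  {𝔤 : Type*} [NormedAddCommGroup 𝔤] [NormedSpace ℝ 𝔤]

/-- A map `c` from a vector space covering a neighbourhood of `1` in a group, such that the group
law is given near `1` by a smooth map `m` on the vector space. -/
structure IsLocalGroupParam (c : 𝔤 → G) (m : 𝔤 × 𝔤 → 𝔤) : Prop where
  nhds_le : 𝓝 1 ≤ map c (𝓝 0)
  contDiffAt : ContDiffAt ℝ ∞ m 0
  left_zero : ∀ X, m (X, 0) = X
  zero_right : ∀ Y, m (0, Y) = Y
  law : ∀ᶠ p in 𝓝 0, c (m p) = c p.1 * c p.2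

/-- Both partial derivatives are the identity because `m` is the identity along each axis: to first
order, the group law is addition. -/
theorem IsLocalGroupParam.hasStrictFDerivAt {c : 𝔤 → G} {m : 𝔤 × 𝔤 → 𝔤}
    (h : IsLocalGroupParam c m) :
    HasStrictFDerivAt m (ContinuousLinearMap.fst ℝ 𝔤 𝔤 + ContinuousLinearMap.snd ℝ 𝔤 𝔤) 0 := by
  have hm := h.contDiffAt.hasStrictFDerivAt (by simp)
  suffices h : ContinuousLinearMap.fst ℝ 𝔤 𝔤 + ContinuousLinearMap.snd ℝ 𝔤 𝔤 = fderiv ℝ m 0 by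
    rw [h]; exact hm
  have h1 : (fderiv ℝ m 0).comp (ContinuousLinearMap.inl ℝ 𝔤 𝔤) = .id ℝ 𝔤 := by
    have : HasFDerivAt (fun X : 𝔤 => m (X, 0)) ((fderiv ℝ m 0).comp (.inl ℝ 𝔤 𝔤)) 0 :=
      HasFDerivAt.comp (g := m) (0 : 𝔤) hm.hasFDerivAt (ContinuousLinearMap.inl ℝ 𝔤 𝔤).hasFDerivAt
    simp only [h.left_zero] at this
    exact this.unique (hasFDerivAt_id 0)
  have h2 : (fderiv ℝ m 0).comp (ContinuousLinearMap.inr ℝ 𝔤 𝔤) = .id ℝ 𝔤 := by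
    have : HasFDerivAt (fun X : 𝔤 => m (0, X)) ((fderiv ℝ m 0).comp (.inr ℝ 𝔤 𝔤)) 0 :=
      HasFDerivAt.comp (g := m) (0 : 𝔤) hm.hasFDerivAt (ContinuousLinearMap.inr ℝ 𝔤 𝔤).hasFDerivAt
    simp only [h.zero_right] at this
    exact this.unique (hasFDerivAt_id 0)
  ext X
  · rw [h1]; simp
  · rw [h2]; simp

variable [ContinuousMul G] [CompactSpace G] [FiniteDimensional ℝ 𝔤]
  {E : Type*} [NormedAddCommGroup E] [NormedSpace ℝ E] [FiniteDimensional ℝ E]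

/-- Orbits of compact groups with a smooth local parametrization have slice charts. -/
theorem IsLocalGroupParam.exists_isSliceChart_orbit {c : 𝔤 → G} {m : 𝔤 × 𝔤 → 𝔤}
    (h : IsLocalGroupParam c m) (π : G →* (E →ₗ[ℝ] E)) {x : E}
    (hπ : Continuous fun g => π g x) (hsm : ContDiff ℝ ∞ fun p : 𝔤 × E => π (c p.1) p.2)
    (hc0 : c 0 = 1) {D : 𝔤 →L[ℝ] E} (hD : HasFDerivAt (fun X => π (c X) x) D 0)
    (hker : ∀ X, D X = 0 → π (c X) x = x) {d : ℕ}
    (hd : Module.finrank ℝ (LinearMap.range (D : 𝔤 →ₗ[ℝ] E)) = d) :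
    ∃ W : Submodule ℝ E, ∃ _ : (EuclideanSpace ℝ (Fin d) × W) ≃L[ℝ] E, ∀ g,
      ∃ Φ : OpenPartialHomeomorph E (EuclideanSpace ℝ (Fin d) × W), π g x ∈ Φ.source ∧
        IsSliceChart (range fun g => π g x) Φ := by
  set T := LinearMap.range (D : 𝔤 →ₗ[ℝ] E) with hT
  obtain ⟨W, hW⟩ := T.exists_isCompl
  let e : EuclideanSpace ℝ (Fin d) ≃ₗ[ℝ] T :=
    LinearEquiv.ofFinrankEq _ _ (by rw [hd, finrank_euclideanSpace_fin])
  -- A linear section `s` of `D` selects directions in the Lie algebra transverse to `ker D`, one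
  -- for each tangent direction of the orbit.
  obtain ⟨s, hs⟩ := (D : 𝔤 →ₗ[ℝ] E).rangeRestrict.exists_rightInverse_of_surjective
    (LinearMap.range_rangeRestrict _)
  have hs' : ∀ t : T, D (s t) = t := fun t =>
    congrArg Subtype.val (LinearMap.congr_fun hs t)
  let j : EuclideanSpace ℝ (Fin d) →L[ℝ] 𝔤 := LinearMap.toContinuousLinearMap (s ∘ₗ e.toLinearMap)
  have hj : ∀ v, D (j v) = e v := fun v => hs' _
  let L₀ : (EuclideanSpace ℝ (Fin d) × W) ≃ₗ[ℝ] E :=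
    (e.prodCongr (LinearEquiv.refl ℝ W)).trans (T.prodEquivOfIsCompl W hW)
  let L := L₀.toContinuousLinearEquiv
  have hL : ∀ v w, L (v, w) = D (j v) + w := fun v w => by
    rw [hj]; exact Submodule.coe_prodEquivOfIsCompl' _ _ hW (e v, w)
  refine ⟨W, L, ?_⟩
  -- The first variable moves along the orbit, the second across it within the complement `W` of the
  -- tangent space. The derivative at `0` is the splitting `L`, so `ψ` is a local diffeomorphism.
  let ψ : EuclideanSpace ℝ (Fin d) × W → E := fun p => π (c (j p.1)) (x + p.2)
  have hψ : ContDiff ℝ ∞ ψ :=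
    hsm.comp (((j.contDiff).comp contDiff_fst).prodMk
      (contDiff_const.add (W.subtypeL.contDiff.comp contDiff_snd)))
  have hψ' : HasFDerivAt ψ (L : _ →L[ℝ] E) 0 := by
    have h0 := (hψ.differentiable (by simp)).differentiableAt (x := 0) |>.hasFDerivAt
    suffices hLψ : (L : _ →L[ℝ] E) = fderiv ℝ ψ 0 by rw [hLψ]; exact h0
    have h1 : HasFDerivAt (fun v : EuclideanSpace ℝ (Fin d) => ψ (v, 0))
        ((fderiv ℝ ψ 0).comp (.inl ℝ _ _)) 0 :=
      HasFDerivAt.comp (g := ψ) (0 : EuclideanSpace ℝ (Fin d)) h0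
        (ContinuousLinearMap.inl ℝ (EuclideanSpace ℝ (Fin d)) W).hasFDerivAt
    have h2 : HasFDerivAt (fun w : W => ψ (0, w)) ((fderiv ℝ ψ 0).comp (.inr ℝ _ _)) 0 :=
      HasFDerivAt.comp (g := ψ) (0 : W) h0
        (ContinuousLinearMap.inr ℝ (EuclideanSpace ℝ (Fin d)) W).hasFDerivAt
    have h3 : HasFDerivAt (fun v : EuclideanSpace ℝ (Fin d) => ψ (v, 0)) (D.comp j) 0 := by
      have hD' : HasFDerivAt (fun X => π (c X) x) D (j 0) := by rwa [map_zero]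
      simpa [ψ, Function.comp_def] using HasFDerivAt.comp 0 hD' j.hasFDerivAt
    have h4 : HasFDerivAt (fun w : W => ψ (0, w)) W.subtypeL 0 := by
      simpa [ψ, hc0] using W.subtypeL.hasFDerivAt.const_add x
    have h13 := h1.unique h3
    have h24 := h2.unique h4
    refine ContinuousLinearMap.ext fun p => ?_
    have hp : p = ContinuousLinearMap.inl ℝ _ _ p.1 + ContinuousLinearMap.inr ℝ _ _ p.2 := by
      simp
    rw [hp, map_add, map_add]
    congr 1
    · rw [← ContinuousLinearMap.comp_apply (fderiv ℝ ψ 0), h13]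
      simpa using hL p.1 0
    · rw [← ContinuousLinearMap.comp_apply (fderiv ℝ ψ 0), h24]
      simpa using hL 0 p.2
  obtain ⟨Ψ, h0Ψ, hΨf, hΨs⟩ := hψ.exists_openPartialHomeomorph hψ'
  have hψ0 : ψ 0 = x := by simp [ψ, hc0]
  -- group elements near `1` move `x` along the parametrized slice
  let r : 𝔤 →L[ℝ] 𝔤 :=
    LinearMap.toContinuousLinearMap (s ∘ₗ (D : 𝔤 →ₗ[ℝ] E).rangeRestrict)
  have hr : ∀ X, j (e.symm ⟨D X, X, rfl⟩) = r X := fun X => by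
    change s (e (e.symm _)) = s _
    rw [e.apply_symm_apply]; rfl
  have hDr : ∀ X, D (X - r X) = 0 := fun X => by
    rw [map_sub, sub_eq_zero]; exact (hs' ⟨D X, X, rfl⟩).symm
  -- `θ` encodes the product `c (r X) * c (X - r X)`. Its right factor comes from `ker D` and so
  -- fixes `x`; its left factor moves `x` along the slice. Since `θ` has derivative the identity,
  -- such products fill a neighbourhood of `1`.
  let θ : 𝔤 → 𝔤 := fun X => m (r X, X - r X)
  have hθ0 : θ 0 = 0 := by simp [θ, h.left_zero]
  have hθ : HasStrictFDerivAt θ (ContinuousLinearEquiv.refl ℝ 𝔤 : 𝔤 →L[ℝ] 𝔤) 0 := by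
    have hm := h.hasStrictFDerivAt
    have hin : HasStrictFDerivAt (fun X : 𝔤 => (r X, X - r X)) (r.prod (.id ℝ 𝔤 - r)) 0 :=
      (r.prod (.id ℝ 𝔤 - r)).hasStrictFDerivAt
    have h00 : ((r 0, (0 : 𝔤) - r 0) : 𝔤 × 𝔤) = 0 := by simp
    rw [← h00] at hm
    have := hm.comp (0 : 𝔤) hin
    convert this using 1
    ext X
    simp
  have hθn : map θ (𝓝 0) = 𝓝 0 := by simpa [hθ0] using hθ.map_nhds_eq_of_equiv
  have hcont : Tendsto (fun X => (r X, X - r X)) (𝓝 (0 : 𝔤)) (𝓝 (0 : 𝔤 × 𝔤)) := by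
    have : Continuous fun X => (r X, X - r X) := by fun_prop
    have h00 : ((r 0, (0 : 𝔤) - r 0) : 𝔤 × 𝔤) = 0 := by simp
    exact h00 ▸ this.tendsto 0
  have hslice : ∀ᶠ X in 𝓝 (0 : 𝔤), ((e.symm ⟨D X, X, rfl⟩ : EuclideanSpace ℝ (Fin d)), (0 : W))
      ∈ Ψ.source := by
    have hlin : Continuous fun X => (e.symm ⟨D X, X, rfl⟩ : EuclideanSpace ℝ (Fin d)) :=
      (e.symm.toLinearMap ∘ₗ (D : 𝔤 →ₗ[ℝ] E).rangeRestrict).continuous_of_finiteDimensional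
    have hcont2 : Continuous fun X =>
      ((e.symm ⟨D X, X, rfl⟩ : EuclideanSpace ℝ (Fin d)), (0 : W)) := hlin.prodMk continuous_const
    refine hcont2.continuousAt.eventually_mem (Ψ.open_source.mem_nhds ?_)
    have : (⟨D 0, 0, rfl⟩ : T) = 0 := Subtype.ext (map_zero D)
    rw [this, map_zero]
    exact h0Ψ
  have hnear : ∀ᶠ g in 𝓝 (1 : G), ∃ v, (v, (0 : W)) ∈ Ψ.source ∧ π g x = ψ (v, 0) := by
    refine h.nhds_le ?_
    change ∀ᶠ Z in 𝓝 (0 : 𝔤), _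
    rw [← hθn]
    change ∀ᶠ X in 𝓝 (0 : 𝔤), _
    filter_upwards [hcont.eventually h.law, hslice] with X hX hXs
    refine ⟨_, hXs, ?_⟩
    change π (c (m (r X, X - r X))) x = π (c (j _)) (x + ((0 : W) : E))
    rw [hX, map_mul, Module.End.mul_apply, hker _ (hDr X), hr, Submodule.coe_zero, add_zero]
  -- Inside `O` all orbit points lie on the slice, including those reached by group elements far
  -- from `1`.
  obtain ⟨O, hO, hOo, hxO⟩ := mem_nhds_iff.1 (eventually_orbit_of_eventually_nhds_one π hπ
    (P := fun y => ∃ v, (v, (0 : W)) ∈ Ψ.source ∧ y = ψ (v, 0)) hnear)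
  refine fun g => IsSliceChart.exists_translate (Φ := Ψ.symm.restrOpen O hOo) π ?_ ?_ g
  · refine ⟨hΨs.mono inter_subset_left, ?_, ?_⟩
    · exact (hΨf ▸ hψ).contDiffOn
    · rintro y ⟨hy, hyO⟩
      change _ ↔ (Ψ.symm y).2 = 0
      constructor
      · intro hyR
        obtain ⟨v, hv, rfl⟩ := hO hyO hyR
        rw [← hΨf, Ψ.left_inv hv]
      · intro h2
        refine ⟨c (j (Ψ.symm y).1), ?_⟩
        have : ψ (Ψ.symm y) = y := by rw [← hΨf]; exact Ψ.right_inv hy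
        refine Eq.trans ?_ this
        simp only [ψ, h2, Submodule.coe_zero, add_zero]
  · refine ⟨?_, hxO⟩
    have := Ψ.map_source h0Ψ
    rwa [hΨf, hψ0] at this
end OrbitSlices

/-! ### Smoothness of matrix operations, entry by entry. -/

section MatrixCalculus

variable {n : ℕ} {V : Type*} [NormedAddCommGroup V] [NormedSpace ℝ V]
  {f g : V → BlockMat n} {x : V}

theorem contDiffAt_matrix_mul (hf : ContDiffAt ℝ ∞ (fun p i j => f p i j) x)
    (hg : ContDiffAt ℝ ∞ (fun p i j => g p i j) x) :
    ContDiffAt ℝ ∞ (fun p i j => (f p * g p) i j) x := by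
  simp only [contDiffAt_pi, Matrix.mul_apply] at *
  exact fun i j => ContDiffAt.sum fun k _ => (hf i k).mul (hg k j)

theorem contDiffAt_matrix_det (hf : ContDiffAt ℝ ∞ (fun p i j => f p i j) x) :
    ContDiffAt ℝ ∞ (fun p => (f p).det) x := by
  simp only [contDiffAt_pi, Matrix.det_apply'] at *
  exact ContDiffAt.sum fun σ _ => contDiffAt_const.mul (contDiffAt_prod fun i _ => hf _ _)

theorem contDiffAt_matrix_inv (hf : ContDiffAt ℝ ∞ (fun p i j => f p i j) x)
    (hx : IsUnit (f x).det) : ContDiffAt ℝ ∞ (fun p i j => (f p)⁻¹ i j) x := by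
  have hdet := contDiffAt_matrix_det hf
  simp only [contDiffAt_pi, Matrix.inv_def, Matrix.smul_apply, Ring.inverse_eq_inv',
    Matrix.adjugate_apply, smul_eq_mul]
  intro i j
  refine (hdet.inv hx.ne_zero).mul (contDiffAt_matrix_det ?_)
  simp only [contDiffAt_pi] at *
  intro k l
  by_cases h : k = j
  · simpa [Matrix.updateRow_apply, h] using contDiffAt_const
  · simpa [Matrix.updateRow_apply, h] using hf k l

/-- Matrix multiplication as a continuous bilinear map. -/
noncomputable def matrixMulBilin (n : ℕ) : EntrySpace n →L[ℝ] EntrySpace n →L[ℝ] EntrySpace n :=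
  LinearMap.toContinuousLinearMap (LinearMap.toContinuousLinearMap.toLinearMap ∘ₗ
    (LinearMap.mul ℝ (BlockMat n) : BlockMat n →ₗ[ℝ] BlockMat n →ₗ[ℝ] BlockMat n))

end MatrixCalculus

/-! ### The Cayley transform between `sp(n)` and `Sp(n)`. -/

section Cayley

variable {n : ℕ}

/-- The Lie algebra `sp(n)` of `Sp(n)`. -/
def spLie (n : ℕ) : Submodule ℝ (EntrySpace n) where
  carrier := {X | (Matrix.of X).conjTranspose = -Matrix.of X ∧
    (Matrix.of X).transpose * sympJ n = -(sympJ n * Matrix.of X)}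
  zero_mem' := by simp
  add_mem' := by
    rintro X Y ⟨h1, h2⟩ ⟨h3, h4⟩
    refine ⟨?_, ?_⟩
    · rw [← Matrix.of_add_of, Matrix.conjTranspose_add, h1, h3, neg_add]
    · rw [← Matrix.of_add_of, Matrix.transpose_add, add_mul, h2, h4, mul_add, neg_add]
  smul_mem' := by
    rintro r X ⟨h1, h2⟩
    refine ⟨?_, ?_⟩
    · rw [← Matrix.smul_of, Matrix.conjTranspose_smul, h1]; simp
    · rw [← Matrix.smul_of, Matrix.transpose_smul, Matrix.smul_mul, h2, Matrix.mul_smul, smul_neg]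

/-- The matrix underlying an element of `sp(n)`. -/
def spLieMat (X : spLie n) : BlockMat n := Matrix.of X.1

/-- For skew-Hermitian `X`, `(1 - X)†(1 - X) = 1 + X†X` is positive definite. Hence the Cayley
transform is defined on all of `sp(n)`. -/
theorem isUnit_det_one_sub_of_skew {X : BlockMat n} (hX : X.conjTranspose = -X) :
    IsUnit (1 - X).det := by
  have h : (1 - X).conjTranspose * (1 - X) = 1 + X.conjTranspose * X := by
    rw [Matrix.conjTranspose_sub, Matrix.conjTranspose_one, hX]; noncomm_ring
  have hp : (1 + X.conjTranspose * X).PosDef :=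
    Matrix.PosDef.one.add_posSemidef (Matrix.posSemidef_conjTranspose_mul_self X)
  have hd := hp.isUnit
  rw [← h, Matrix.isUnit_iff_isUnit_det, Matrix.det_mul] at hd
  exact isUnit_of_mul_isUnit_right hd

/-- The Cayley transform. -/
noncomputable def cayley (X : BlockMat n) : BlockMat n := (1 + X) * (1 - X)⁻¹

/-- The inverse of the Cayley transform. -/
noncomputable def cayleyInv (S : BlockMat n) : BlockMat n := (S - 1) * (S + 1)⁻¹

theorem cayley_mul {X : BlockMat n} (hX : IsUnit (1 - X).det) :
    cayley X * (1 - X) = 1 + X := by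
  rw [cayley, Matrix.mul_assoc, Matrix.nonsing_inv_mul _ hX, Matrix.mul_one]

theorem cayleyInv_mul {S : BlockMat n} (hS : IsUnit (S + 1).det) :
    cayleyInv S * (S + 1) = S - 1 := by
  rw [cayleyInv, Matrix.mul_assoc, Matrix.nonsing_inv_mul _ hS, Matrix.mul_one]

/-- `(cayley X + 1)(1 - X) = (1 + X) + (1 - X) = 2`. -/
theorem isUnit_det_cayley_add_one {X : BlockMat n} (hX : IsUnit (1 - X).det) :
    IsUnit (cayley X + 1).det := by
  have h : (cayley X + 1) * ((1 / 2 : ℂ) • (1 - X)) = 1 := by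
    rw [Matrix.mul_smul, add_mul, cayley_mul hX, one_mul, add_add_sub_cancel, ← two_smul ℂ,
      smul_smul]
    norm_num
  exact (Matrix.isUnit_iff_isUnit_det _).1 (IsUnit.of_mul_eq_one _ h)

theorem cayleyInv_cayley {X : BlockMat n} (hX : IsUnit (1 - X).det) :
    cayleyInv (cayley X) = X := by
  have h1 := cayleyInv_mul (isUnit_det_cayley_add_one hX)
  have hu := (Matrix.isUnit_iff_isUnit_det _).2 (isUnit_det_cayley_add_one hX)
  have hu' := (Matrix.isUnit_iff_isUnit_det _).2 hX
  apply hu.mul_left_injective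
  apply hu'.mul_left_injective
  simp only
  rw [h1, sub_mul, Matrix.mul_assoc, add_mul, cayley_mul hX]
  noncomm_ring

theorem isUnit_det_one_sub_cayleyInv {S : BlockMat n} (hS : IsUnit (S + 1).det) :
    IsUnit (1 - cayleyInv S).det := by
  have h : (1 - cayleyInv S) * ((1 / 2 : ℂ) • (S + 1)) = 1 := by
    rw [Matrix.mul_smul, sub_mul, cayleyInv_mul hS, one_mul, add_sub_sub_cancel, ← two_smul ℂ,
      smul_smul]
    norm_num
  exact (Matrix.isUnit_iff_isUnit_det _).1 (IsUnit.of_mul_eq_one _ h)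

theorem cayley_cayleyInv {S : BlockMat n} (hS : IsUnit (S + 1).det) :
    cayley (cayleyInv S) = S := by
  have h1 := cayley_mul (isUnit_det_one_sub_cayleyInv hS)
  have hu := (Matrix.isUnit_iff_isUnit_det _).2 (isUnit_det_one_sub_cayleyInv hS)
  have hu' := (Matrix.isUnit_iff_isUnit_det _).2 hS
  apply hu.mul_left_injective
  apply hu'.mul_left_injective
  simp only
  rw [h1, add_mul, Matrix.mul_assoc, sub_mul, cayleyInv_mul hS]
  noncomm_ring

/-- Multiplying by `(1 - X)†` on the left and `1 - X` on the right clears the inverses and leaves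
`(1 + X)†(1 + X) = (1 - X)†(1 - X)`. The symplectic identity and the converse for `cayleyInv` are
cleared of inverses in the same manner. -/
theorem cayley_mem_unitaryGroup {X : BlockMat n} (hX : X.conjTranspose = -X) :
    cayley X ∈ Matrix.unitaryGroup (Fin n ⊕ Fin n) ℂ := by
  have hd := isUnit_det_one_sub_of_skew hX
  have hu := (Matrix.isUnit_iff_isUnit_det _).2 hd
  have hk := cayley_mul hd
  have hu' : IsUnit (1 - X).conjTranspose := by
    rw [← Matrix.star_eq_conjTranspose]; exact hu.star
  rw [Matrix.mem_unitaryGroup_iff', Matrix.star_eq_conjTranspose]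
  apply hu.mul_left_injective
  apply hu'.mul_right_injective
  simp only
  calc (1 - X).conjTranspose * ((cayley X).conjTranspose * cayley X * (1 - X))
      = (cayley X * (1 - X)).conjTranspose * (cayley X * (1 - X)) := by
        rw [Matrix.conjTranspose_mul]; simp only [Matrix.mul_assoc]
    _ = (1 - X).conjTranspose * (1 * (1 - X)) := by
        rw [hk, Matrix.conjTranspose_add, Matrix.conjTranspose_sub, Matrix.conjTranspose_one, hX]
        noncomm_ring

theorem cayley_symplectic {X : BlockMat n} (hX : X.conjTranspose = -X)
    (hX' : X.transpose * sympJ n = -(sympJ n * X)) :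
    (cayley X).transpose * sympJ n * cayley X = sympJ n := by
  have hd := isUnit_det_one_sub_of_skew hX
  have hu := (Matrix.isUnit_iff_isUnit_det _).2 hd
  have hk := cayley_mul hd
  have hu' : IsUnit (1 - X).transpose := by
    rw [Matrix.isUnit_iff_isUnit_det, Matrix.det_transpose]; exact hd
  apply hu.mul_left_injective
  apply hu'.mul_right_injective
  simp only
  have h1 : (1 + X.transpose) * sympJ n = sympJ n * (1 - X) := by
    rw [add_mul, hX']; noncomm_ring
  have h2 : (1 - X.transpose) * sympJ n = sympJ n * (1 + X) := by
    rw [sub_mul, hX']; noncomm_ring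
  calc (1 - X).transpose * ((cayley X).transpose * sympJ n * cayley X * (1 - X))
      = (cayley X * (1 - X)).transpose * sympJ n * (cayley X * (1 - X)) := by
        rw [Matrix.transpose_mul]; simp only [Matrix.mul_assoc]
    _ = (1 - X).transpose * (sympJ n * (1 - X)) := by
        rw [hk, Matrix.transpose_add, Matrix.transpose_sub, Matrix.transpose_one,
          ← Matrix.mul_assoc, h1, h2]
        noncomm_ring

theorem cayleyInv_mem_spLie {S : BlockMat n} (hS : S.conjTranspose * S = 1)
    (hS' : S.transpose * sympJ n * S = sympJ n) (hd : IsUnit (S + 1).det) :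
    (cayleyInv S : EntrySpace n) ∈ spLie n := by
  have hu := (Matrix.isUnit_iff_isUnit_det _).2 hd
  have hk := cayleyInv_mul hd
  have hu1 : IsUnit (S + 1).conjTranspose := by
    rw [← Matrix.star_eq_conjTranspose]; exact hu.star
  have hu2 : IsUnit (S + 1).transpose := by
    rw [Matrix.isUnit_iff_isUnit_det, Matrix.det_transpose]; exact hd
  change (cayleyInv S).conjTranspose = -cayleyInv S ∧
    (cayleyInv S).transpose * sympJ n = -(sympJ n * cayleyInv S)
  constructor
  · rw [← add_eq_zero_iff_eq_neg]
    apply hu.mul_left_injective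
    apply hu1.mul_right_injective
    simp only
    calc (S + 1).conjTranspose * (((cayleyInv S).conjTranspose + cayleyInv S) * (S + 1))
        = (cayleyInv S * (S + 1)).conjTranspose * (S + 1)
          + (S + 1).conjTranspose * (cayleyInv S * (S + 1)) := by
          rw [Matrix.conjTranspose_mul, add_mul, mul_add]; simp only [Matrix.mul_assoc]
      _ = 2 * (S.conjTranspose * S) - 2 * 1 := by
          rw [hk, Matrix.conjTranspose_add, Matrix.conjTranspose_sub, Matrix.conjTranspose_one]
          noncomm_ring
      _ = (S + 1).conjTranspose * (0 * (S + 1)) := by rw [hS]; simp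
  · rw [← add_eq_zero_iff_eq_neg]
    apply hu.mul_left_injective
    apply hu2.mul_right_injective
    simp only
    calc (S + 1).transpose * (((cayleyInv S).transpose * sympJ n + sympJ n * cayleyInv S) * (S + 1))
        = (cayleyInv S * (S + 1)).transpose * sympJ n * (S + 1)
          + (S + 1).transpose * sympJ n * (cayleyInv S * (S + 1)) := by
          rw [Matrix.transpose_mul, add_mul, mul_add]; simp only [Matrix.mul_assoc]
      _ = 2 * (S.transpose * sympJ n * S) - 2 * sympJ n := by
          rw [hk, Matrix.transpose_add, Matrix.transpose_sub, Matrix.transpose_one]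
          noncomm_ring
      _ = (S + 1).transpose * (0 * (S + 1)) := by rw [hS']; simp

/-- This passes from the infinitesimal stabilizer to the stabilizer: directions killed by the
bracket give group elements that fix `ρ`. -/
theorem cayley_commute {X ρ : BlockMat n} (hX : IsUnit (1 - X).det) (h : X * ρ = ρ * X) :
    cayley X * ρ = ρ * cayley X := by
  have hu := (Matrix.isUnit_iff_isUnit_det _).2 hX
  have hk := cayley_mul hX
  apply hu.mul_left_injective
  simp only
  have h1 : ρ * (1 - X) = (1 - X) * ρ := by rw [mul_sub, sub_mul, h]; simp
  rw [Matrix.mul_assoc, h1, ← Matrix.mul_assoc, hk, Matrix.mul_assoc, hk, add_mul, mul_add, h]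
  simp

end Cayley

/-! ### `Sp(n)` as a compact group with Cayley coordinates. -/

section SpGroup

variable {n : ℕ}

theorem spMat_injective : Function.Injective (spMat : Sp n → BlockMat n) :=
  fun _ _ h => Subtype.ext (Subtype.ext h)

theorem spMat_one : spMat (1 : Sp n) = 1 := rfl

theorem spMat_mul (S T : Sp n) : spMat (S * T) = spMat S * spMat T := rfl

theorem spMat_conjTranspose_mul (S : Sp n) : (spMat S).conjTranspose * spMat S = 1 :=
  Matrix.mem_unitaryGroup_iff'.1 S.1.2

theorem spMat_mul_conjTranspose (S : Sp n) : spMat S * (spMat S).conjTranspose = 1 :=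
  Matrix.mem_unitaryGroup_iff.1 S.1.2

theorem spMat_symplectic (S : Sp n) : (spMat S).transpose * sympJ n * spMat S = sympJ n := S.2

theorem isEmbedding_spMat_entries :
    IsEmbedding (fun (S : Sp n) (i j : Fin n ⊕ Fin n) => spMat S i j) := by
  have h1 : IsEmbedding (fun S : Sp n => (S : Matrix.unitaryGroup (Fin n ⊕ Fin n) ℂ)) :=
    IsEmbedding.subtypeVal
  have h2 : IsEmbedding (fun U : Matrix.unitaryGroup (Fin n ⊕ Fin n) ℂ => (U : BlockMat n)) :=
    IsEmbedding.subtypeVal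
  exact h2.comp h1

theorem continuous_spMat : Continuous (spMat : Sp n → BlockMat n) :=
  isEmbedding_spMat_entries.continuous

theorem range_spMat : range (spMat : Sp n → BlockMat n) =
    {M | M.conjTranspose * M = 1 ∧ M.transpose * sympJ n * M = sympJ n} := by
  ext M
  constructor
  · rintro ⟨S, rfl⟩
    exact ⟨spMat_conjTranspose_mul S, spMat_symplectic S⟩
  · rintro ⟨h1, h2⟩
    exact ⟨⟨⟨M, Matrix.mem_unitaryGroup_iff'.2 h1⟩, h2⟩, rfl⟩

instance compactSpace_Sp : CompactSpace (Sp n) := by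
  rw [← isCompact_univ_iff, isEmbedding_spMat_entries.isCompact_iff, image_univ]
  apply Metric.isCompact_of_isClosed_isBounded
  · have h1 : IsClosed {M : BlockMat n | M.conjTranspose * M = 1 ∧
        M.transpose * sympJ n * M = sympJ n} :=
      (isClosed_eq (by fun_prop) continuous_const).inter (isClosed_eq (by fun_prop) continuous_const)
    rw [← range_spMat] at h1
    exact h1
  · refine (Metric.isBounded_closedBall (x := (0 : EntrySpace n)) (r := 1)).subset ?_
    rintro _ ⟨S, rfl⟩
    rw [mem_closedBall_zero_iff, pi_norm_le_iff_of_nonneg zero_le_one]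
    intro i
    rw [pi_norm_le_iff_of_nonneg zero_le_one]
    exact fun j => entry_norm_bound_of_unitary S.1.2 i j

/-- The Cayley transform `sp(n) → Sp(n)`. -/
noncomputable def spCayley (X : spLie n) : Sp n :=
  ⟨⟨cayley (spLieMat X), cayley_mem_unitaryGroup X.2.1⟩, cayley_symplectic X.2.1 X.2.2⟩

theorem spMat_spCayley (X : spLie n) : spMat (spCayley X) = cayley (spLieMat X) := rfl

theorem spLieMat_zero : spLieMat (0 : spLie n) = 0 := rfl

theorem spCayley_zero : spCayley (0 : spLie n) = 1 := by
  apply spMat_injective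
  simp [spMat_spCayley, spLieMat_zero, cayley, spMat_one]

theorem isUnit_det_one_sub_spLieMat (X : spLie n) : IsUnit (1 - spLieMat X).det :=
  isUnit_det_one_sub_of_skew X.2.1

theorem contDiff_spLieMat : ContDiff ℝ ∞ (fun (X : spLie n) i j => spLieMat X i j) :=
  (spLie n).subtypeL.contDiff

theorem contDiff_spCayley : ContDiff ℝ ∞ (fun (X : spLie n) i j => spMat (spCayley X) i j) := by
  rw [contDiff_iff_contDiffAt]
  intro X
  let e : EntrySpace n := (1 : BlockMat n)
  have h1 : ContDiff ℝ ∞ (fun (X : spLie n) i j => (1 + spLieMat X) i j) :=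
    contDiff_const (c := e).add contDiff_spLieMat
  have h2 : ContDiff ℝ ∞ (fun (X : spLie n) i j => (1 - spLieMat X) i j) :=
    contDiff_const (c := e).sub contDiff_spLieMat
  exact contDiffAt_matrix_mul h1.contDiffAt
    (contDiffAt_matrix_inv h2.contDiffAt (isUnit_det_one_sub_spLieMat X))

/-- A linear projection of the space of matrices onto `sp(n)`. -/
noncomputable def spLieProj (n : ℕ) : EntrySpace n →L[ℝ] spLie n :=
  LinearMap.toContinuousLinearMap
    ((spLie n).subtype.exists_leftInverse_of_injective (spLie n).ker_subtype).choose

theorem spLieProj_coe (X : spLie n) : spLieProj n X = X :=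
  LinearMap.congr_fun
    ((spLie n).subtype.exists_leftInverse_of_injective (spLie n).ker_subtype).choose_spec X

/-- A local inverse of the Cayley transform `sp(n) → Sp(n)`. -/
noncomputable def spCayleyInv (S : Sp n) : spLie n := spLieProj n (cayleyInv (spMat S))

theorem spCayleyInv_spCayley (X : spLie n) : spCayleyInv (spCayley X) = X := by
  rw [spCayleyInv, spMat_spCayley, cayleyInv_cayley (isUnit_det_one_sub_spLieMat X)]
  exact spLieProj_coe X

/-- Invertibility of `S + 1` places `cayleyInv (spMat S)` in `sp(n)`, where the projection
`spLieProj` is the identity. -/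
theorem spCayley_spCayleyInv {S : Sp n} (hS : IsUnit (spMat S + 1).det) :
    spCayley (spCayleyInv S) = S := by
  have hmem := cayleyInv_mem_spLie (spMat_conjTranspose_mul S) (spMat_symplectic S) hS
  have h : spLieMat (spCayleyInv S) = cayleyInv (spMat S) :=
    congrArg Subtype.val (spLieProj_coe ⟨_, hmem⟩)
  apply spMat_injective
  rw [spMat_spCayley, h, cayley_cayleyInv hS]

theorem isUnit_det_one_add_one : IsUnit (1 + 1 : BlockMat n).det := by
  rw [← Matrix.isUnit_iff_isUnit_det]
  have h : (1 + 1 : BlockMat n) * ((1 / 2 : ℂ) • 1) = 1 := by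
    rw [Matrix.mul_smul, mul_one, ← two_smul ℂ, smul_smul]; norm_num
  exact IsUnit.of_mul_eq_one _ h

theorem contDiffAt_spCayleyInv {V : Type*} [NormedAddCommGroup V] [NormedSpace ℝ V]
    {f : V → Sp n} {x : V} (hf : ContDiffAt ℝ ∞ (fun p i j => spMat (f p) i j) x)
    (hx : IsUnit (spMat (f x) + 1).det) : ContDiffAt ℝ ∞ (fun p => spCayleyInv (f p)) x := by
  let e : EntrySpace n := (1 : BlockMat n)
  refine (spLieProj n).contDiff.contDiffAt.comp x ?_
  have h1 : ContDiffAt ℝ ∞ (fun p i j => (spMat (f p) - 1) i j) x :=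
    hf.sub (contDiffAt_const (c := e))
  have h2 : ContDiffAt ℝ ∞ (fun p i j => (spMat (f p) + 1) i j) x :=
    hf.add (contDiffAt_const (c := e))
  exact contDiffAt_matrix_mul h1 (contDiffAt_matrix_inv h2 hx)

/-- The group law in Cayley coordinates is smooth at `0`, as it is built from matrix products and
inverses. The unit laws hold globally because `spCayleyInv` is a left inverse everywhere; the
product law needs `S + 1` invertible, which holds near `1`. -/
theorem isLocalGroupParam_spCayley : IsLocalGroupParam (spCayley : spLie n → Sp n)
    (fun p => spCayleyInv (spCayley p.1 * spCayley p.2)) := by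
  have hnear : ∀ᶠ S in 𝓝 (1 : Sp n), IsUnit (spMat S + 1).det := by
    have hc : Continuous fun S : Sp n => (spMat S + 1).det :=
      (continuous_spMat.add continuous_const).matrix_det
    have := hc.continuousAt.eventually_ne (x := 1) (y := 0)
      (by rw [spMat_one]; exact isUnit_det_one_add_one.ne_zero)
    filter_upwards [this] with S hS using hS.isUnit
  have hmul : ContDiff ℝ ∞
      (fun (p : spLie n × spLie n) i j => spMat (spCayley p.1 * spCayley p.2) i j) := by
    rw [contDiff_iff_contDiffAt]
    exact fun p => contDiffAt_matrix_mul (contDiff_spCayley.comp contDiff_fst).contDiffAt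
      (contDiff_spCayley.comp contDiff_snd).contDiffAt
  refine ⟨?_, ?_, ?_, ?_, ?_⟩
  · have ht : Tendsto (spCayleyInv : Sp n → spLie n) (𝓝 1) (𝓝 0) := by
      have h1 : ContinuousAt (fun S : Sp n => cayleyInv (spMat S)) 1 := by
        have hc : Continuous fun S : Sp n => spMat S + 1 := continuous_spMat.add continuous_const
        have hdet : ContinuousAt (fun S : Sp n => (spMat S + 1).det⁻¹) 1 :=
          hc.matrix_det.continuousAt.inv₀
            (by rw [spMat_one]; exact isUnit_det_one_add_one.ne_zero)
        have hinv := hdet.smul hc.matrix_adjugate.continuousAt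
        simp only [cayleyInv, Matrix.inv_def, Ring.inverse_eq_inv']
        exact (continuous_spMat.sub continuous_const).continuousAt.mul hinv
      have h2 : ContinuousAt (spCayleyInv : Sp n → spLie n) 1 :=
        ContinuousAt.comp (g := spLieProj n) (spLieProj n).continuous.continuousAt h1
      have h3 : spCayleyInv (1 : Sp n) = 0 := by rw [← spCayley_zero, spCayleyInv_spCayley]
      exact h3 ▸ h2.tendsto
    intro s hs
    filter_upwards [ht hs, hnear] with S hS hS'
    have hS'' : spCayley (spCayleyInv S) ∈ s := hS
    rwa [spCayley_spCayleyInv hS'] at hS''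
  · refine contDiffAt_spCayleyInv hmul.contDiffAt ?_
    simpa [spCayley_zero, spMat_one] using isUnit_det_one_add_one
  · intro X
    simp only [spCayley_zero, mul_one, spCayleyInv_spCayley]
  · intro X
    simp only [spCayley_zero, one_mul, spCayleyInv_spCayley]
  · have hc : Continuous fun p : spLie n × spLie n => spCayley p.1 * spCayley p.2 :=
      isEmbedding_spMat_entries.continuous_iff.2 hmul.continuous
    have ht : Tendsto (fun p : spLie n × spLie n => spCayley p.1 * spCayley p.2) (𝓝 0) (𝓝 1) := by
      simpa [spCayley_zero] using hc.tendsto 0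
    filter_upwards [ht.eventually hnear] with p hp using spCayley_spCayleyInv hp

/-- Differentiating `cayley X * (1 - X) = 1 + X` at `0` gives `k' X - X = X`. -/
theorem hasFDerivAt_spCayley : HasFDerivAt (fun (X : spLie n) i j => spMat (spCayley X) i j)
    ((2 : ℝ) • (spLie n).subtypeL) 0 := by
  have hk := (contDiff_spCayley (n := n)).differentiable (by simp) 0 |>.hasFDerivAt
  set k' := fderiv ℝ (fun (X : spLie n) i j => spMat (spCayley X) i j) 0
  let e : EntrySpace n := (1 : BlockMat n)
  have hs : HasFDerivAt (fun (X : spLie n) => e - X.1)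
      (-(spLie n).subtypeL) 0 := (spLie n).subtypeL.hasFDerivAt.const_sub _
  have ha : HasFDerivAt (fun (X : spLie n) => e + X.1)
      (spLie n).subtypeL 0 := (spLie n).subtypeL.hasFDerivAt.const_add _
  have hm := (matrixMulBilin n).hasFDerivAt_of_bilinear hk hs
  have he : (fun X : spLie n => matrixMulBilin n (fun i j => spMat (spCayley X) i j)
      (e - X.1)) =
      fun X => e + X.1 :=
    funext fun X => cayley_mul (isUnit_det_one_sub_spLieMat X)
  rw [he] at hm
  have hu := hm.unique ha
  suffices hk2 : k' = (2 : ℝ) • (spLie n).subtypeL by rw [← hk2]; exact hk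
  refine ContinuousLinearMap.ext fun X => ?_
  have hX : spMat (spCayley (0 : spLie n)) * (-Matrix.of X.1) + Matrix.of (k' X) *
      ((1 : BlockMat n) - 0) = Matrix.of X.1 := DFunLike.congr_fun hu X
  rw [spCayley_zero, spMat_one, sub_zero, mul_one, one_mul, neg_add_eq_iff_eq_add] at hX
  exact hX.trans (two_smul ℝ _).symm

end SpGroup

/-! ### Every orbit is a homogeneous manifold. -/

section Homogeneous

variable {n : ℕ}

theorem contDiff_matrix_mul {V : Type*} [NormedAddCommGroup V] [NormedSpace ℝ V]
    {f g : V → BlockMat n} (hf : ContDiff ℝ ∞ (fun p i j => f p i j))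
    (hg : ContDiff ℝ ∞ (fun p i j => g p i j)) : ContDiff ℝ ∞ (fun p i j => (f p * g p) i j) :=
  contDiff_iff_contDiffAt.2 fun _ => contDiffAt_matrix_mul hf.contDiffAt hg.contDiffAt

theorem contDiff_matrix_conjTranspose {V : Type*} [NormedAddCommGroup V] [NormedSpace ℝ V]
    {f : V → BlockMat n} (hf : ContDiff ℝ ∞ (fun p i j => f p i j)) :
    ContDiff ℝ ∞ (fun p i j => (f p).conjTranspose i j) := by
  simp only [contDiff_pi] at *
  exact fun i j => Complex.conjCLE.contDiff.comp (hf j i)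

/-- A map into a smoothly embedded manifold is smooth as soon as it is smooth into the ambient
space. -/
theorem Manifold.IsSmoothEmbedding.contMDiff_of_comp {E F E' H H' M N : Type*}
    [NormedAddCommGroup E] [NormedSpace ℝ E] [NormedAddCommGroup F] [NormedSpace ℝ F]
    [NormedAddCommGroup E'] [NormedSpace ℝ E'] [TopologicalSpace H] [TopologicalSpace H']
    {I : ModelWithCorners ℝ F H} {I' : ModelWithCorners ℝ E' H'}
    [TopologicalSpace M] [ChartedSpace H M] [TopologicalSpace N] [ChartedSpace H' N]
    {ι : M → E} (hι : IsSmoothEmbedding I 𝓘(ℝ, E) ∞ ι) {f : N → M}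
    (hf : ContMDiff I' 𝓘(ℝ, E) ∞ (ι ∘ f)) : ContMDiff I' I ∞ f :=
  (ContMDiff.iff_comp_isImmersion hι.isImmersion).2
    ⟨hι.isEmbedding.continuous_iff.2 hf.continuous, hf⟩

/-- The representation of `Sp(n)` on matrices by left multiplication. -/
def spLeftRep (n : ℕ) : Sp n →* (EntrySpace n →ₗ[ℝ] EntrySpace n) where
  toFun S :=
    { toFun := fun M => spMat S * Matrix.of M
      map_add' := fun M N => Matrix.mul_add _ (Matrix.of M) (Matrix.of N)
      map_smul' := fun r M => Matrix.mul_smul _ r (Matrix.of M) }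
  map_one' := LinearMap.ext fun M => Matrix.one_mul (Matrix.of M)
  map_mul' _ _ := LinearMap.ext fun M => Matrix.mul_assoc _ _ (Matrix.of M)

/-- The representation of `Sp(n)` on matrices by conjugation. -/
def spConjRep (n : ℕ) : Sp n →* (EntrySpace n →ₗ[ℝ] EntrySpace n) where
  toFun S :=
    { toFun := fun M => spConj S (Matrix.of M)
      map_add' := fun M N => by
        change spMat S * (Matrix.of M + Matrix.of N) * _ = _
        rw [Matrix.mul_add, Matrix.add_mul]; rfl
      map_smul' := fun r M => by
        change spMat S * (r • Matrix.of M) * _ = _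
        rw [Matrix.mul_smul, Matrix.smul_mul]; rfl }
  map_one' := LinearMap.ext fun M => spConj_one (Matrix.of M)
  map_mul' S T := LinearMap.ext fun M => spConj_mul S T (Matrix.of M)

/-- The infinitesimal action `X ↦ X ρ - ρ X` of `sp(n)`. -/
def spLieBracket (ρ : BlockMat n) : spLie n →ₗ[ℝ] EntrySpace n where
  toFun X := spLieMat X * ρ - ρ * spLieMat X
  map_add' X Y := by
    have : spLieMat (X + Y) = spLieMat X + spLieMat Y := rfl
    rw [this, add_mul, mul_add, add_sub_add_comm]; rfl
  map_smul' r X := by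
    have : spLieMat (r • X) = r • spLieMat X := rfl
    rw [this, Matrix.smul_mul, Matrix.mul_smul, ← smul_sub]; rfl

theorem contDiff_spConj : ContDiff ℝ ∞
    (fun (p : EntrySpace n × EntrySpace n) i j =>
      (Matrix.of p.1 * Matrix.of p.2 * (Matrix.of p.1).conjTranspose) i j) :=
  contDiff_matrix_mul (contDiff_matrix_mul contDiff_fst contDiff_snd)
    (contDiff_matrix_conjTranspose contDiff_fst)

theorem contDiff_spConj_spCayley (ρ : BlockMat n) :
    ContDiff ℝ ∞ (fun (X : spLie n) i j => spConj (spCayley X) ρ i j) := by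
  have h : ContDiff ℝ ∞ (fun (_ : spLie n) i j => ρ i j) := contDiff_const
  exact contDiff_matrix_mul (contDiff_matrix_mul contDiff_spCayley h)
    (contDiff_matrix_conjTranspose contDiff_spCayley)

/-- Differentiating `(S ρ S†) S = S ρ` at `S = 1` gives `ρ (2X) + F' X = (2X) ρ`, without
differentiating the adjoint. -/
theorem hasFDerivAt_spConj_spCayley (ρ : BlockMat n) :
    HasFDerivAt (fun (X : spLie n) i j => spConj (spCayley X) ρ i j)
      ((2 : ℝ) • LinearMap.toContinuousLinearMap (spLieBracket ρ)) 0 := by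
  have hk := hasFDerivAt_spCayley (n := n)
  let r : EntrySpace n := ρ
  have hF := (contDiff_spConj_spCayley ρ).differentiable (by simp) 0 |>.hasFDerivAt
  set F' := fderiv ℝ (fun (X : spLie n) i j => spConj (spCayley X) ρ i j) 0
  suffices h : F' = (2 : ℝ) • LinearMap.toContinuousLinearMap (spLieBracket ρ) by
    rw [← h]; exact hF
  have hl := (matrixMulBilin n).hasFDerivAt_of_bilinear hF hk
  have hr := (matrixMulBilin n).hasFDerivAt_of_bilinear hk (hasFDerivAt_const r (0 : spLie n))
  have he : (fun X : spLie n => matrixMulBilin n (spConj (spCayley X) ρ)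
      (fun i j => spMat (spCayley X) i j)) =
      fun X => matrixMulBilin n (fun i j => spMat (spCayley X) i j) r := by
    funext X
    change spMat (spCayley X) * ρ * (spMat (spCayley X)).conjTranspose * spMat (spCayley X) =
      spMat (spCayley X) * ρ
    rw [Matrix.mul_assoc, spMat_conjTranspose_mul, Matrix.mul_one]
  rw [he] at hl
  have hu := hl.unique hr
  refine ContinuousLinearMap.ext fun X => ?_
  have hX : spConj (spCayley (0 : spLie n)) ρ * ((2 : ℝ) • spLieMat X) +
      Matrix.of (F' X) * spMat (spCayley (0 : spLie n)) =
      spMat (spCayley (0 : spLie n)) * 0 + ((2 : ℝ) • spLieMat X) * ρ := DFunLike.congr_fun hu X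
  rw [spCayley_zero, spConj_one, spMat_one, mul_one, mul_zero, zero_add, ← eq_sub_iff_add_eq',
    Matrix.smul_mul, Matrix.mul_smul, ← smul_sub] at hX
  exact hX

/-- `Sp(n)` is the orbit of the identity matrix under left multiplication. The derivative there is
twice the inclusion of `sp(n)`, so its kernel is trivial. -/
theorem exists_isSmoothEmbedding_Sp (n : ℕ) :
    ∃ (m : ℕ) (_ : ChartedSpace (EuclideanSpace ℝ (Fin m)) (Sp n)),
      IsManifold (𝓡 m) ∞ (Sp n) ∧
      Manifold.IsSmoothEmbedding (𝓡 m) 𝓘(ℝ, EntrySpace n) ∞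
        (fun (S : Sp n) (i j : Fin n ⊕ Fin n) => spMat S i j) := by
  let e : EntrySpace n := (1 : BlockMat n)
  have he : (fun S : Sp n => spLeftRep n S e) = fun (S : Sp n) i j => spMat S i j :=
    funext fun S => Matrix.mul_one (spMat S)
  have hcd : ContDiff ℝ ∞ fun p : spLie n × EntrySpace n => spLeftRep n (spCayley p.1) p.2 :=
    contDiff_matrix_mul (contDiff_spCayley.comp contDiff_fst) contDiff_snd
  have hD : HasFDerivAt (fun X : spLie n => spLeftRep n (spCayley X) e)
      ((2 : ℝ) • (spLie n).subtypeL) 0 := by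
    have h := hasFDerivAt_spCayley (n := n)
    have h' : (fun X : spLie n => spLeftRep n (spCayley X) e) =
      fun X i j => spMat (spCayley X) i j := funext fun X => congrFun he (spCayley X)
    rwa [h']
  obtain ⟨W, L, hL⟩ := isLocalGroupParam_spCayley.exists_isSliceChart_orbit (spLeftRep n)
    (x := e) (by rw [he]; exact isEmbedding_spMat_entries.continuous) hcd spCayley_zero hD
    (fun X hX => by
      have h2 : (2 : ℝ) • X.1 = 0 := hX
      have hX0 : X = 0 := Subtype.ext ((smul_eq_zero_iff_right two_ne_zero).1 h2)
      rw [hX0, spCayley_zero, map_one]; rfl) rfl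
  rw [he] at hL
  refine ⟨_, exists_isSmoothEmbedding_of_isSliceChart isEmbedding_spMat_entries L fun S => ?_⟩
  obtain ⟨Φ, hS, hΦ⟩ := hL S
  exact ⟨Φ, (congrFun he S) ▸ hS, hΦ⟩

theorem isEmbedding_spOrbit_entries (ρ : BlockMat n) :
    IsEmbedding (fun (x : spOrbit ρ) (i j : Fin n ⊕ Fin n) => (x : BlockMat n) i j) :=
  IsEmbedding.subtypeVal

theorem continuous_spConj (ρ : BlockMat n) : Continuous fun S : Sp n => spConj S ρ :=
  (continuous_spMat.mul continuous_const).mul continuous_spMat.matrix_conjTranspose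

theorem exists_isSmoothEmbedding_spOrbit (ρ : BlockMat n) :
    ∃ _ : ChartedSpace
        (EuclideanSpace ℝ (Fin (Module.finrank ℝ (LinearMap.range (spLieBracket ρ)))))
        (spOrbit ρ),
      IsManifold (𝓡 (Module.finrank ℝ (LinearMap.range (spLieBracket ρ)))) ∞ (spOrbit ρ) ∧
      Manifold.IsSmoothEmbedding (𝓡 (Module.finrank ℝ (LinearMap.range (spLieBracket ρ))))
        𝓘(ℝ, EntrySpace n) ∞
        (fun (x : spOrbit ρ) (i j : Fin n ⊕ Fin n) => (x : BlockMat n) i j) := by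
  let r : EntrySpace n := ρ
  have hcd : ContDiff ℝ ∞ fun p : spLie n × EntrySpace n => spConjRep n (spCayley p.1) p.2 := by
    have h := contDiff_spCayley (n := n).comp (contDiff_fst (E := spLie n) (F := EntrySpace n))
    exact contDiff_matrix_mul (contDiff_matrix_mul h contDiff_snd)
      (contDiff_matrix_conjTranspose h)
  -- The factor `2` from the Cayley transform does not change the range, hence not the dimension.
  have hrange : LinearMap.range (((2 : ℝ) • LinearMap.toContinuousLinearMap (spLieBracket ρ) :
      spLie n →L[ℝ] EntrySpace n) : spLie n →ₗ[ℝ] EntrySpace n) =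
      LinearMap.range (spLieBracket ρ) :=
    LinearMap.range_smul (spLieBracket ρ) (2 : ℝ) two_ne_zero
  obtain ⟨W, L, hL⟩ := isLocalGroupParam_spCayley.exists_isSliceChart_orbit (spConjRep n)
    (x := r) (continuous_spConj ρ) hcd spCayley_zero (hasFDerivAt_spConj_spCayley ρ)
    (fun X hX => by
      have h2 : (2 : ℝ) • spLieBracket ρ X = 0 := hX
      have h3 : spLieMat X * ρ - ρ * spLieMat X = 0 :=
        (smul_eq_zero_iff_right two_ne_zero).1 h2
      have h4 := cayley_commute (isUnit_det_one_sub_spLieMat X) (sub_eq_zero.1 h3)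
      change spMat (spCayley X) * ρ * (spMat (spCayley X)).conjTranspose = ρ
      rw [spMat_spCayley, h4, ← spMat_spCayley, Matrix.mul_assoc, spMat_mul_conjTranspose,
        Matrix.mul_one]) (congrArg (fun T : Submodule ℝ (EntrySpace n) => Module.finrank ℝ T) hrange)
  have hr : (range fun S : Sp n => spConjRep n S r) =
      range (fun (x : spOrbit ρ) (i j : Fin n ⊕ Fin n) => (x : BlockMat n) i j) :=
    (Subtype.range_coe (s := spOrbit ρ)).symm
  rw [hr] at hL
  refine exists_isSmoothEmbedding_of_isSliceChart (isEmbedding_spOrbit_entries ρ) L ?_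
  rintro ⟨_, S, rfl⟩
  exact hL S

/-- A continuous bijection from a compact space to a Hausdorff space is a homeomorphism. -/
theorem isHomeomorph_spQuotientMap (ρ : BlockMat n) : IsHomeomorph (spQuotientMap ρ) := by
  have hcont : Continuous (spQuotientMap ρ) :=
    Continuous.quotient_lift ((continuous_spConj ρ).subtype_mk _) _
  rw [isHomeomorph_iff_continuous_bijective]
  refine ⟨hcont, ?_, ?_⟩
  · intro a b
    induction a using QuotientGroup.induction_on with | _ S
    induction b using QuotientGroup.induction_on with | _ T
    intro h
    have h' : spConj S ρ = spConj T ρ := congrArg Subtype.val h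
    rw [QuotientGroup.eq]
    change spConj (S⁻¹ * T) ρ = ρ
    rw [spConj_mul, ← h', ← spConj_mul, inv_mul_cancel, spConj_one]
  · rintro ⟨_, S, rfl⟩
    exact ⟨QuotientGroup.mk S, rfl⟩

/-- Every orbit of `Sp(n)` is a homogeneous manifold. -/
theorem isHomogeneousManifoldOfDim_finrank (ρ : BlockMat n) :
    IsHomogeneousManifoldOfDim ρ (Module.finrank ℝ (LinearMap.range (spLieBracket ρ))) := by
  obtain ⟨m, cG, hG, heG⟩ := exists_isSmoothEmbedding_Sp n
  obtain ⟨cO, hO, heO⟩ := exists_isSmoothEmbedding_spOrbit ρ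
  refine ⟨m, cG, cO, ?_, heG, hO, heO, ?_, isHomeomorph_spQuotientMap ρ⟩
  · have hmul : ContMDiff ((𝓡 m).prod (𝓡 m)) (𝓡 m) ∞ fun p : Sp n × Sp n => p.1 * p.2 := by
      refine heG.contMDiff_of_comp ?_
      have h : ContDiff ℝ ∞ (fun (p : EntrySpace n × EntrySpace n) i j =>
          (Matrix.of p.1 * Matrix.of p.2) i j) :=
        contDiff_matrix_mul contDiff_fst contDiff_snd
      exact h.contMDiff.comp
        ((heG.contMDiff.comp contMDiff_fst).prodMk_space (heG.contMDiff.comp contMDiff_snd))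
    -- On unitary matrices the inverse is the conjugate transpose, which is real linear on the
    -- ambient space.
    have hinv : ContMDiff (𝓡 m) (𝓡 m) ∞ fun S : Sp n => S⁻¹ := by
      refine heG.contMDiff_of_comp ?_
      have h : ContDiff ℝ ∞ (fun (p : EntrySpace n) i j =>
          (Matrix.of p).conjTranspose i j) :=
        contDiff_matrix_conjTranspose contDiff_id
      exact h.contMDiff.comp heG.contMDiff
    exact { toContMDiffMul := { toIsManifold := hG, contMDiff_mul := hmul }
            contMDiff_inv := hinv }
  · refine heO.contMDiff_of_comp ?_
    have h := (heG.contMDiff.comp contMDiff_fst).prodMk_space (heO.contMDiff.comp contMDiff_snd)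
    have hc := contDiff_spConj (n := n)
    set F := fun (p : EntrySpace n × EntrySpace n) i j =>
      (Matrix.of p.1 * Matrix.of p.2 * (Matrix.of p.1).conjTranspose) i j with hF
    have hcomp := hc.contMDiff.comp h
    have he : (fun (x : spOrbit ρ) (i j : Fin n ⊕ Fin n) => (x : BlockMat n) i j) ∘
        (fun p : Sp n × spOrbit ρ => spOrbitAct ρ p.1 p.2) = F ∘ fun p : Sp n × spOrbit ρ =>
          ((fun i j => spMat p.1 i j : EntrySpace n),
            (fun i j => (p.2 : BlockMat n) i j : EntrySpace n)) := rfl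
    rw [he]
    exact hcomp

end Homogeneous

/-! ### Block computations: ranks of the bracket and the stabilizer. -/

section Blocks

variable {n : ℕ}

theorem conjTranspose_transpose_eq (A : Matrix (Fin n) (Fin n) ℂ) :
    A.conjTranspose.transpose = A.transpose.conjTranspose := rfl

theorem spConj_eq_self_iff (S : Sp n) (ρ : BlockMat n) :
    spConj S ρ = ρ ↔ spMat S * ρ = ρ * spMat S := by
  rw [spConj]
  constructor
  · intro h
    calc spMat S * ρ = spMat S * ρ * ((spMat S).conjTranspose * spMat S) := by
          rw [spMat_conjTranspose_mul, Matrix.mul_one]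
      _ = ρ * spMat S := by rw [← Matrix.mul_assoc, h]
  · intro h
    rw [h, Matrix.mul_assoc, spMat_mul_conjTranspose, Matrix.mul_one]

theorem mem_spLie_iff_exists_blocks (X : EntrySpace n) : X ∈ spLie n ↔
    ∃ A B : Matrix (Fin n) (Fin n) ℂ, A.conjTranspose = -A ∧ B.transpose = B ∧
      Matrix.of X = Matrix.fromBlocks A B (-B.conjTranspose) (-A.transpose) := by
  change (Matrix.of X).conjTranspose = -Matrix.of X ∧
    (Matrix.of X).transpose * sympJ n = -(sympJ n * Matrix.of X) ↔ _
  generalize (Matrix.of X : BlockMat n) = M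
  constructor
  · rintro ⟨h1, h2⟩
    obtain ⟨A, B, C, D, rfl⟩ : ∃ A B C D, M = Matrix.fromBlocks A B C D :=
      ⟨_, _, _, _, (Matrix.fromBlocks_toBlocks M).symm⟩
    simp only [sympJ, Matrix.fromBlocks_conjTranspose, Matrix.fromBlocks_neg,
      Matrix.fromBlocks_transpose, Matrix.fromBlocks_multiply, Matrix.fromBlocks_inj,
      mul_zero, zero_mul, mul_one, one_mul, zero_add, add_zero, mul_neg, neg_mul, neg_neg] at h1 h2
    obtain ⟨hA, hC, hB, hD⟩ := h1
    obtain ⟨hC', hA', hD', hB'⟩ := h2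
    refine ⟨A, B, hA, hB', ?_⟩
    rw [hB, neg_neg, hA', neg_neg]
  · rintro ⟨A, B, hA, hB, rfl⟩
    have hB' : B.conjTranspose.transpose = B.conjTranspose := by
      rw [conjTranspose_transpose_eq, hB]
    have hA' : A.transpose.conjTranspose = -A.transpose := by
      rw [← conjTranspose_transpose_eq, hA, Matrix.transpose_neg]
    simp [sympJ, Matrix.fromBlocks_conjTranspose, Matrix.fromBlocks_neg,
      Matrix.fromBlocks_transpose, Matrix.fromBlocks_multiply, hA, hB, hA', hB']

theorem finrank_range_spLieBracket_le {σ : Matrix (Fin n) (Fin n) ℂ} (hσ : σ.IsDiag) :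
    Module.finrank ℝ (LinearMap.range (spLieBracket (Matrix.fromBlocks σ 0 0 σ))) ≤
      2 * n ^ 2 - 1 := by
  obtain ⟨d, rfl⟩ : ∃ d, σ = Matrix.diagonal d := ⟨_, hσ.diagonal_diag.symm⟩
  set ρ : BlockMat n := Matrix.fromBlocks (Matrix.diagonal d) 0 0 (Matrix.diagonal d) with hρ
  -- For `i < j` the pair `(i, j)` records an entry of the `A` block, for `i > j` one of the `B`
  -- block. The remaining off-diagonal entries follow by symmetry, so `n² - n` complex numbers
  -- determine the bracket.
  let r : EntrySpace n →ₗ[ℝ] ((Finset.univ : Finset (Fin n)).offDiag → ℂ) :=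
    { toFun := fun M p => if p.1.1 < p.1.2 then M (.inl p.1.1) (.inl p.1.2)
        else M (.inl p.1.1) (.inr p.1.2)
      map_add' := fun M N => by
        funext p
        simp only [Pi.add_apply]
        split_ifs <;> rfl
      map_smul' := fun c M => by
        funext p
        simp only [Pi.smul_apply, RingHom.id_apply]
        split_ifs <;> rfl }
  have hinj : Function.Injective (r.domRestrict (LinearMap.range (spLieBracket ρ))) := by
    rw [injective_iff_map_eq_zero]
    rintro ⟨_, X, rfl⟩ h0
    obtain ⟨A, B, hA, hB, hX⟩ := (mem_spLie_iff_exists_blocks X.1).1 X.2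
    have hbr : (Matrix.of (spLieBracket ρ X) : BlockMat n) = Matrix.fromBlocks
        (A * Matrix.diagonal d - Matrix.diagonal d * A)
        (B * Matrix.diagonal d - Matrix.diagonal d * B)
        (-B.conjTranspose * Matrix.diagonal d - Matrix.diagonal d * -B.conjTranspose)
        (-A.transpose * Matrix.diagonal d - Matrix.diagonal d * -A.transpose) := by
      have hX' : spLieMat X = _ := hX
      change spLieMat X * ρ - ρ * spLieMat X = _
      rw [hX', hρ, Matrix.fromBlocks_multiply, Matrix.fromBlocks_multiply,
        sub_eq_add_neg, Matrix.fromBlocks_neg, Matrix.fromBlocks_add]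
      simp [sub_eq_add_neg]
    have hr : ∀ p : (Finset.univ : Finset (Fin n)).offDiag,
        (if p.1.1 < p.1.2 then Matrix.of (spLieBracket ρ X) (.inl p.1.1) (.inl p.1.2)
        else Matrix.of (spLieBracket ρ X) (.inl p.1.1) (.inr p.1.2)) = 0 := fun p => congrFun h0 p
    rw [hbr] at hr
    simp only [Matrix.fromBlocks_apply₁₁, Matrix.fromBlocks_apply₁₂, Matrix.sub_apply,
      Matrix.mul_diagonal, Matrix.diagonal_mul] at hr
    have key : ∀ z x y : ℂ, z * x - y * z = 0 → z = 0 ∨ x = y := fun z x y h => by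
      have : z * (x - y) = 0 := by linear_combination h
      exact (mul_eq_zero.1 this).imp_right sub_eq_zero.1
    have hAz : ∀ i j, A i j = 0 ∨ d j = d i := by
      intro i j
      rcases lt_trichotomy i j with hij | rfl | hij
      · have := hr ⟨(i, j), by simp [hij.ne]⟩
        rw [if_pos hij] at this
        exact key _ _ _ this
      · exact Or.inr rfl
      · have := hr ⟨(j, i), by simp [hij.ne]⟩
        rw [if_pos hij] at this
        refine (key _ _ _ this).imp (fun h => ?_) Eq.symm
        have := congrFun (congrFun hA i) j
        rw [Matrix.conjTranspose_apply, h, star_zero, Matrix.neg_apply] at this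
        exact neg_eq_zero.1 this.symm
    have hBz : ∀ i j, B i j = 0 ∨ d j = d i := by
      have hBs : ∀ i j, B j i = B i j := fun i j => congrFun (congrFun hB i) j
      intro i j
      rcases lt_trichotomy i j with hij | rfl | hij
      · have := hr ⟨(j, i), by simp [hij.ne']⟩
        rw [if_neg hij.not_gt] at this
        exact (key _ _ _ this).imp (fun h => hBs i j ▸ h) Eq.symm
      · exact Or.inr rfl
      · have := hr ⟨(i, j), by simp [hij.ne']⟩
        rw [if_neg hij.not_gt] at this
        exact key _ _ _ this
    refine Subtype.ext ?_
    change (Matrix.of (spLieBracket ρ X) : BlockMat n) = 0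
    rw [hbr, ← Matrix.fromBlocks_zero, Matrix.fromBlocks_inj]
    refine ⟨?_, ?_, ?_, ?_⟩ <;> ext i j <;>
      simp only [Matrix.sub_apply, Matrix.mul_diagonal, Matrix.diagonal_mul, Matrix.neg_apply,
        Matrix.conjTranspose_apply, Matrix.transpose_apply, Matrix.zero_apply]
    · rcases hAz i j with h | h <;> rw [h] <;> ring
    · rcases hBz i j with h | h <;> rw [h]
      · ring
      · ring
    · rcases hBz j i with h | h <;> rw [h]
      · simp
      · ring
    · rcases hAz j i with h | h <;> rw [h] <;> ring
  have hle := LinearMap.finrank_le_finrank_of_injective hinj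
  rw [Module.finrank_pi_fintype] at hle
  simp only [Complex.finrank_real_complex, Finset.sum_const, Finset.card_univ,
    Fintype.card_coe, Finset.offDiag_card, Fintype.card_fin, smul_eq_mul] at hle
  refine hle.trans ?_
  -- The subtraction is truncated: for `n = 0` both sides are `0`, and for `n ≥ 1` one has `2n² - 2n
  -- ≤ 2n² - 1`.
  rcases Nat.eq_zero_or_pos n with rfl | hn
  · simp
  · have : n ≤ n * n := Nat.le_mul_self n
    rw [pow_two]
    omega

/-- The matrices `[[0, B], [B†, 0]]` with `B` symmetric. -/
def offDiagSymm (n : ℕ) : (Sym2 (Fin n) → ℂ) →ₗ[ℝ] EntrySpace n where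
  toFun f := Matrix.fromBlocks 0 (Matrix.of fun i j => f s(i, j))
    (Matrix.of fun i j => f s(i, j)).conjTranspose 0
  map_add' f g := by
    have h : ∀ B C : Matrix (Fin n) (Fin n) ℂ,
        Matrix.fromBlocks 0 (B + C) (B + C).conjTranspose 0 =
        Matrix.fromBlocks 0 B B.conjTranspose 0 + Matrix.fromBlocks 0 C C.conjTranspose 0 :=
      fun B C => by rw [Matrix.fromBlocks_add, Matrix.conjTranspose_add, add_zero]
    exact h _ _
  map_smul' c f := by
    have h : ∀ B : Matrix (Fin n) (Fin n) ℂ,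
        Matrix.fromBlocks 0 (c • B) (c • B).conjTranspose 0 =
        c • Matrix.fromBlocks 0 B B.conjTranspose 0 :=
      fun B => by
        rw [Matrix.fromBlocks_smul, smul_zero, Matrix.conjTranspose_smul, star_trivial]
    exact h _

theorem offDiagSymm_injective (n : ℕ) : Function.Injective (offDiagSymm n) := by
  intro f g h
  funext z
  induction z using Sym2.ind with | _ i j
  exact congrFun (congrFun h (.inl i)) (.inr j)

theorem finrank_sym2_complex (n : ℕ) : Module.finrank ℝ (Sym2 (Fin n) → ℂ) = n ^ 2 + n := by
  rw [Module.finrank_pi_fintype]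
  simp only [Complex.finrank_real_complex, Finset.sum_const, Finset.card_univ, Sym2.card,
    Fintype.card_fin, smul_eq_mul, Nat.choose_two_right, Nat.add_sub_cancel]
  rw [Nat.div_mul_cancel]
  · ring
  · rw [mul_comm]; exact (Nat.even_mul_succ_self n).two_dvd

/-- Scalar blocks commute with `A`, so the diagonal blocks cancel and only the difference of the two
scalars acts on `B`. -/
theorem spLieBracket_blockScalar (a b : ℝ) {X : spLie n} {A B : Matrix (Fin n) (Fin n) ℂ}
    (hX : spLieMat X = Matrix.fromBlocks A B (-B.conjTranspose) (-A.transpose)) :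
    spLieBracket (Matrix.fromBlocks ((a : ℂ) • (1 : Matrix (Fin n) (Fin n) ℂ)) 0 0
      ((b : ℂ) • 1)) X = Matrix.fromBlocks 0 ((b - a) • B) ((b - a) • B).conjTranspose 0 := by
  change spLieMat X * Matrix.fromBlocks _ _ _ _ - Matrix.fromBlocks _ _ _ _ * spLieMat X = _
  rw [hX, Matrix.fromBlocks_multiply, Matrix.fromBlocks_multiply,
    sub_eq_add_neg, Matrix.fromBlocks_neg, Matrix.fromBlocks_add, Matrix.fromBlocks_inj]
  refine ⟨?_, ?_, ?_, ?_⟩ <;> ext i j <;> simp <;> ring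

theorem range_spLieBracket_blockScalar {a b : ℝ} (hab : a ≠ b) :
    LinearMap.range (spLieBracket (Matrix.fromBlocks
      ((a : ℂ) • (1 : Matrix (Fin n) (Fin n) ℂ)) 0 0 ((b : ℂ) • 1))) =
      LinearMap.range (offDiagSymm n) := by
  apply le_antisymm
  · rintro _ ⟨X, rfl⟩
    obtain ⟨A, B, hA, hB, hX⟩ := (mem_spLie_iff_exists_blocks X.1).1 X.2
    refine ⟨Sym2.lift ⟨fun i j => (b - a) • B i j, fun i j => ?_⟩, ?_⟩
    · exact congrArg ((b - a) • ·) (congrFun (congrFun hB i) j).symm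
    · rw [spLieBracket_blockScalar a b hX]
      rfl
  · rintro _ ⟨f, rfl⟩
    set B : Matrix (Fin n) (Fin n) ℂ := Matrix.of fun i j => f s(i, j) with hBdef
    have hB : B.transpose = B := by
      ext i j
      simp [B, Sym2.eq_swap]
    -- The factor `(b - a)⁻¹` undoes the scaling by the bracket; the `A` block plays no role and is
    -- set to `0`.
    let X : EntrySpace n := Matrix.fromBlocks 0 ((b - a)⁻¹ • B)
      (-((b - a)⁻¹ • B).conjTranspose) (-(0 : Matrix (Fin n) (Fin n) ℂ).transpose)
    have hX : X ∈ spLie n := (mem_spLie_iff_exists_blocks X).2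
      ⟨0, (b - a)⁻¹ • B, by simp, by rw [Matrix.transpose_smul, hB], rfl⟩
    refine ⟨⟨X, hX⟩, ?_⟩
    have h : spLieMat ⟨X, hX⟩ = _ := rfl
    rw [spLieBracket_blockScalar a b h, smul_inv_smul₀ (sub_ne_zero.2 hab.symm)]
    rfl

theorem finrank_range_spLieBracket_blockScalar {a b : ℝ} (hab : a ≠ b) :
    Module.finrank ℝ (LinearMap.range (spLieBracket (Matrix.fromBlocks
      ((a : ℂ) • (1 : Matrix (Fin n) (Fin n) ℂ)) 0 0 ((b : ℂ) • 1)))) = n ^ 2 + n := by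
  rw [range_spLieBracket_blockScalar hab,
    LinearMap.finrank_range_of_inj (offDiagSymm_injective n), finrank_sym2_complex]

/-- Fixing `ρ` means commuting with it, and `a ≠ b` then kills the off-diagonal blocks. The
symplectic condition becomes `Aᵀ D = 1`, which for unitary `A` forces `D` to be the conjugate of
`A`. -/
theorem image_spStabilizer_blockScalar {a b : ℝ} (hab : a ≠ b) :
    (fun S : Sp n => spMat S) ''
        (spStabilizer (Matrix.fromBlocks ((a : ℂ) • (1 : Matrix (Fin n) (Fin n) ℂ)) 0 0
          ((b : ℂ) • 1)) : Set (Sp n)) =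
      {M | ∃ A ∈ Matrix.unitaryGroup (Fin n) ℂ,
        M = Matrix.fromBlocks A 0 0 (A.map (starRingEnd ℂ))} := by
  have hab' : (a : ℂ) ≠ b := fun h => hab (Complex.ofReal_injective h)
  have hconj : ∀ A : Matrix (Fin n) (Fin n) ℂ,
      A.map (starRingEnd ℂ) = A.conjTranspose.transpose := fun A => rfl
  ext M
  constructor
  · rintro ⟨S, hS, rfl⟩
    have hS' := (spConj_eq_self_iff S _).1 hS
    have hu := spMat_conjTranspose_mul S
    have hJ := spMat_symplectic S
    change ∃ A ∈ Matrix.unitaryGroup (Fin n) ℂ, spMat S = _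
    generalize spMat S = M at hS' hu hJ
    obtain ⟨A, B, C, D, rfl⟩ : ∃ A B C D, M = Matrix.fromBlocks A B C D :=
      ⟨_, _, _, _, (Matrix.fromBlocks_toBlocks M).symm⟩
    simp only [Matrix.fromBlocks_multiply, Matrix.fromBlocks_inj, mul_zero, zero_mul, add_zero,
      zero_add, Matrix.mul_smul, Matrix.smul_mul, mul_one, one_mul, true_and, and_true] at hS'
    have hB : B = 0 := by
      have := sub_eq_zero.2 hS'.1
      rw [← sub_smul] at this
      exact (smul_eq_zero.1 this).resolve_left (sub_ne_zero.2 hab'.symm)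
    have hC : C = 0 := by
      have := sub_eq_zero.2 hS'.2
      rw [← sub_smul] at this
      exact (smul_eq_zero.1 this).resolve_left (sub_ne_zero.2 hab')
    subst hB hC
    rw [← Matrix.fromBlocks_one] at hu
    simp only [sympJ, Matrix.fromBlocks_conjTranspose, Matrix.fromBlocks_transpose,
      Matrix.fromBlocks_multiply, Matrix.fromBlocks_inj, Matrix.conjTranspose_zero,
      Matrix.transpose_zero, mul_zero, zero_mul, add_zero, zero_add, mul_one, mul_neg] at hu hJ
    have hA : A ∈ Matrix.unitaryGroup (Fin n) ℂ := Matrix.mem_unitaryGroup_iff'.2 hu.1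
    have hA' : A * A.conjTranspose = 1 := Matrix.mem_unitaryGroup_iff.1 hA
    refine ⟨A, hA, ?_⟩
    have hD : D = A.map (starRingEnd ℂ) := by
      calc D = A.conjTranspose.transpose * A.transpose * D := by
            rw [← Matrix.transpose_mul, hA', Matrix.transpose_one, one_mul]
        _ = A.map (starRingEnd ℂ) := by rw [Matrix.mul_assoc, hJ.2.1, mul_one, hconj]
    rw [hD]
  · rintro ⟨A, hA, rfl⟩
    have hA1 : A.conjTranspose * A = 1 := Matrix.mem_unitaryGroup_iff'.1 hA
    have hA2 : A * A.conjTranspose = 1 := Matrix.mem_unitaryGroup_iff.1 hA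
    have h1 : A.transpose * A.conjTranspose.transpose = 1 := by
      rw [← Matrix.transpose_mul, hA1, Matrix.transpose_one]
    have h2 : A.conjTranspose.transpose.transpose * A = 1 := by
      rw [Matrix.transpose_transpose, hA1]
    have h3 : A.conjTranspose.transpose.conjTranspose * A.conjTranspose.transpose = 1 := by
      rw [conjTranspose_transpose_eq, Matrix.conjTranspose_conjTranspose]
      exact h1
    obtain ⟨S, hS⟩ : Matrix.fromBlocks A 0 0 (A.map (starRingEnd ℂ)) ∈
        range (spMat : Sp n → BlockMat n) := by
      rw [range_spMat, hconj]
      constructor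
      · simp [Matrix.fromBlocks_conjTranspose, Matrix.fromBlocks_multiply, hA1, h3]
      · simp [sympJ, Matrix.fromBlocks_transpose, Matrix.fromBlocks_multiply, hA1, h1]
    refine ⟨S, ?_, hS⟩
    refine (spConj_eq_self_iff S _).2 ?_
    rw [hS]
    simp [Matrix.fromBlocks_multiply]

end Blocks

theorem proposition4p3 (n : ℕ) :
    (∀ σ : Matrix (Fin n) (Fin n) ℂ, σ.IsDiag → σ.PosSemidef →
      (∀ c : ℂ, σ ≠ c • (1 : Matrix (Fin n) (Fin n) ℂ)) →
      ∃ d : ℕ, d ≤ 2 * n ^ 2 - 1 ∧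
        IsHomogeneousManifoldOfDim (Matrix.fromBlocks σ 0 0 σ) d) ∧
    (∀ a b : ℝ, 0 ≤ a → a ≤ 1 → 0 ≤ b → b ≤ 1 → a ≠ b →
      ((fun S : Sp n => spMat S) ''
          (spStabilizer (Matrix.fromBlocks ((a : ℂ) • (1 : Matrix (Fin n) (Fin n) ℂ)) 0 0
            ((b : ℂ) • 1)) : Set (Sp n)) =
        {M | ∃ A ∈ Matrix.unitaryGroup (Fin n) ℂ,
          M = Matrix.fromBlocks A 0 0 (A.map (starRingEnd ℂ))}) ∧
      IsHomogeneousManifoldOfDim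
        (Matrix.fromBlocks ((a : ℂ) • (1 : Matrix (Fin n) (Fin n) ℂ)) 0 0 ((b : ℂ) • 1))
        (n ^ 2 + n)) := by
  refine ⟨fun σ hσ _ _ => ⟨_, finrank_range_spLieBracket_le hσ,
    isHomogeneousManifoldOfDim_finrank _⟩, fun a b _ _ _ _ hab =>
    ⟨image_spStabilizer_blockScalar hab, ?_⟩⟩
  rw [← finrank_range_spLieBracket_blockScalar hab]
  exact isHomogeneousManifoldOfDim_finrank _
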